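/- For $\alpha,\alpha',\beta,\beta',\gamma\in\mathbb C$ with $\operatorname{Re}\gamma>0$, $x>0$ and $f:(0,\infty)\to\mathbb C$ let $$\bigl(I_{0,+}^{\alpha,\alpha',\beta,\beta',\gamma}f\bigr)(x)=\frac{x^{-\alpha}}{\Gamma(\gamma)}\int_0^x(x-t)^{\gamma-1}t^{-\alpha'}F_3\Bigl(\alpha,\alpha',\beta,\beta';\gamma;1-\frac tx,1-\frac xt\Bigr)f(t)\,dt$$ be the left-sided Marichev–Saigo–Maeda operator, where Appell's function $F_3$ is the analytic continuation to $\{|z|<1,\ \operatorname{Re}w<\tfrac12\}$ of the double series $$F_3(a,a',b,b';c;z,w)=\sum_{m,n\ge 0}\frac{(a)_m(a')_n(b)_m(b')_n}{(c)_{m+n}\,m!\,n!}z^mw^n$$ from a neighbourhood of the origin. For $p,b,c\in\mathbb C$ let $$\mathcal W_{p,b,c}(z)=\sum_{k=0}^\infty\frac{(-1)^kc^k}{\Gamma\bigl(p+\frac{b+1}2+k\bigr)k!}\Bigl(\frac z2\Bigr)^{2k+p}$$ be the generalized Bessel function of the first kind, and let $${}_m\psi_n\left[\begin{array}{c}(a_i,\alpha_i)_{1,m}\\(b_j,\beta_j)_{1,n}\end{array}\bigg|\,z\right]=\sum_{k=0}^\infty\frac{\prod_{i=1}^m\Gamma(a_i+\alpha_ik)}{\prod_{j=1}^n\Gamma(b_j+\beta_jk)}\frac{z^k}{k!}$$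 be the generalized Wright function, with $1/\Gamma$ read as an entire function. **Theorem 1.** Let $\alpha,\alpha',\beta,\beta',\gamma,\rho,p,b,c\in\mathbb C$ be such that $\kappa:=p+\frac{b+1}2\notin\{0,-1,-2,\dots\}$, $\operatorname{Re}\gamma>0$ and $$\operatorname{Re}(\rho+p)>\max\{0,\ \operatorname{Re}(\alpha+\alpha'+\beta-\gamma),\ \operatorname{Re}(\alpha'-\beta')\}.$$ Then for every $x>0$ the integral defining $\bigl(I_{0,+}^{\alpha,\alpha',\beta,\beta',\gamma}\,t^{\rho-1}\mathcal W_{p,b,c}(t)\bigr)(x)$ converges absolutely, the Wright series below converges, and $$\bigl(I_{0,+}^{\alpha,\alpha',\beta,\beta',\gamma}\,t^{\rho-1}\mathcal W_{p,b,c}(t)\bigr)(x)=\frac{x^{\rho+p-\alpha-\alpha'+\gamma-1}}{2^p}\;{}_3\psi_4\left[\begin{array}{c}(\rho+p,2),\ (\rho+p+\gamma-\alpha-\alpha'-\beta,2),\ (\rho+p+\beta'-\alpha',2)\\(\rho+p+\beta',2),\ (\rho+p+\gamma-\alpha-\alpha',2),\ (\rho+p+\gamma-\alpha'-\beta,2),\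 (\kappa,1)\end{array}\bigg|\,-\frac{cx^2}4\right].$$ -/

import Mathlib

open scoped Nat

noncomputable section

/-- The rising factorial (Pochhammer symbol) `(a)_n = a (a + 1) ⋯ (a + n - 1)`. -/
def poch (a : ℂ) (n : ℕ) : ℂ := (ascPochhammer ℂ n).eval a

/-- The double power series of Appell's function `F₃`,
`∑_{m,n} (a)_m (a')_n (b)_m (b')_n / ((c)_{m+n} m! n!) z^m w^n`, absolutely convergent for
`|z| < 1`, `|w| < 1`. -/
def appellF3Series (a a' b b' c z w : ℂ) : ℂ :=
  ∑' q : ℕ × ℕ, poch a q.1 * poch a' q.2 * poch b q.1 * poch b' q.2 /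
    (poch c (q.1 + q.2) * (q.1 ! : ℂ) * (q.2 ! : ℂ)) * z ^ q.1 * w ^ q.2

/-- The convex open region `|z| < 1`, `Re w < 1/2` of `ℂ²`. It contains the origin and all the
points `(1 - t/x, 1 - x/t)`, `0 < t ≤ x`, at which the kernel of the fractional integral needs
`F₃`; these points leave the region of convergence of the double series as soon as `t ≤ x/2`. -/
def appellF3Region : Set (ℂ × ℂ) := {q | ‖q.1‖ < 1 ∧ q.2.re < 1 / 2}

/-- `F` is the analytic continuation of the double series `F₃(a, a', b, b'; c; z, w)`: it is
holomorphic on the region (complex differentiable as a function of two variables) and equals the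
double series near the origin. Since the region is open and connected, these two properties
determine `F` on the region. -/
def IsAppellF3 (a a' b b' c : ℂ) (F : ℂ × ℂ → ℂ) : Prop :=
  DifferentiableOn ℂ F appellF3Region ∧
    ∀ᶠ q in nhds (0 : ℂ × ℂ), F q = appellF3Series a a' b b' c q.1 q.2

/-- Appell's function `F₃(a, a', b, b'; c; z, w)` on the region `|z| < 1`, `Re w < 1/2`:
the analytic continuation of its double series. -/
def appellF3 (a a' b b' c z w : ℂ) : ℂ :=
  Classical.epsilon (IsAppellF3 a a' b b' c) (z, w)

/-- The integrand `(x - t)^(γ-1) t^(-α') F₃(α, α', β, β'; γ; 1 - t/x, 1 - x/t) f(t)` of the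
left-sided Marichev-Saigo-Maeda fractional integral. -/
def msmLeftIntegrand (α α' β β' γ : ℂ) (f : ℝ → ℂ) (x t : ℝ) : ℂ :=
  ((x - t : ℝ) : ℂ) ^ (γ - 1) * (t : ℂ) ^ (-α') *
    appellF3 α α' β β' γ (1 - (t : ℂ) / (x : ℂ)) (1 - (x : ℂ) / (t : ℂ)) * f t

/-- The left-sided Marichev-Saigo-Maeda fractional integral operator
`(I_{0,+}^{α,α',β,β',γ} f)(x)`. -/
def msmLeft (α α' β β' γ : ℂ) (f : ℝ → ℂ) (x : ℝ) : ℂ :=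
  (x : ℂ) ^ (-α) / Complex.Gamma γ * ∫ t in (0 : ℝ)..x, msmLeftIntegrand α α' β β' γ f x t

/-- The generalized Bessel function of the first kind
`W_{p,b,c}(z) = ∑_k (-1)^k c^k / (Γ(p + (b+1)/2 + k) k!) (z/2)^(2k+p)` (principal powers). -/
def genBessel (p b c z : ℂ) : ℂ :=
  ∑' k : ℕ, (-1) ^ k * c ^ k / (Complex.Gamma (p + (b + 1) / 2 + k) * (k ! : ℂ)) *
    (z / 2) ^ (2 * (k : ℂ) + p)

/-- The `k`-th term of the generalized Wright series with upper parameters `A i = (a_i, α_i)` and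
lower parameters `B j = (b_j, β_j)`. At a pole of `Γ`, Mathlib's `Γ` and its inverse are `0`, so
that the factors `1 / Γ(b_j + β_j k)` are the values of the entire function `1 / Γ`. -/
def wrightTerm {m n : ℕ} (A : Fin m → ℂ × ℝ) (B : Fin n → ℂ × ℝ) (z : ℂ) (k : ℕ) : ℂ :=
  (∏ i, Complex.Gamma ((A i).1 + ((A i).2 : ℂ) * k)) /
    (∏ j, Complex.Gamma ((B j).1 + ((B j).2 : ℂ) * k)) * (z ^ k / (k ! : ℂ))

/-- The generalized Wright function `_mψ_n`. -/
def wrightPsi {m n : ℕ} (A : Fin m → ℂ × ℝ) (B : Fin n → ℂ × ℝ) (z : ℂ) : ℂ :=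
  ∑' k : ℕ, wrightTerm A B z k

end

/-!
# The Marichev–Saigo–Maeda integral of a power times a generalized Bessel function

Put `z = 1 - t/x` and `w = 1 - x/t`. Pfaff's transformation in the second variable gives, on the
whole region `|z| < 1`, `Re w < 1/2`,
`F₃(a, a', b, b'; c; z, w) = (1 - w)^(-a') ∑_{m,n} T(m, n) / (c)_{m+n} z^m u^n`, `u = w / (w - 1)`,
where `T` is `norlundTerm`: the right-hand side is holomorphic there and agrees with the double
series near the origin (`isAppellF3_pfaffSeries`), and the continuation is unique because the region
is convex (`IsAppellF3.eqOn`). On the curve that carries the kernel, `u = z`, hence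
`t^(-α') F₃ = x^(-α') ∑_N g_N / (γ)_N (1 - t/x)^N` with `g_N = ∑_{m+n=N} T(m, n)`, the numbers
`norlundCoeff`. Against `(x - t)^(γ-1) t^(s-1)`, termwise integration yields Beta integrals, and the
Mellin transform of the kernel becomes `Γ(γ) Γ(s) ∑_N g_N / Γ(γ + s + N)`, up to a power of `x`.
Two applications of Gauss's summation theorem (`hasSum_gaussTerm`) evaluate the sum as a quotient of
Gamma functions, `norlundProd` (`hasSum_norlundCoeff_div`).

The delicate point is the range of `s`. If `Re α' > 0`, the double series converges absolutely in
the full range `Re s > 0`, `Re (s + β' - α') > 0`, `Re (s + γ - α - α' - β) > 0`; if `Re α' < 0`, it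
need not, because of cancellation in the inner sums. The Gamma quotient, however, is invariant under
certain substitutions of the parameters, and the coefficients of an inverse factorial series are
unique (`eq_zero_of_tsum_div_Gamma_eq_zero`), so that the `g_N` share this invariance
(`norlundCoeff_symm_left`, `norlundCoeff_symm_right`). The substitutions bring `β` or `γ - β - β'`
into the place of `α'`; interchanging `α'` and `β'` in `F₃` gives also `γ - α' - β`. Since
`α' + β + (γ - α' - β) = γ` has positive real part, one of the three has, and the Mellin transform
is known in the full range (`msmKernel_mellin`).

Finally `t^(ρ-1) W(t)` is `t^(ρ+p-1)` times a power series in `t ^ 2` that converges everywhere, so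
that integration and summation may be interchanged; the terms obtained are those of the Wright
series, whose convergence comes with the interchange.
-/

open scoped Nat
open Filter Topology Asymptotics Finset MeasureTheory

/-! ### Pochhammer symbols and the growth of the Gamma function -/

theorem poch_zero (a : ℂ) : poch a 0 = 1 := by simp [poch]

theorem poch_succ (a : ℂ) (n : ℕ) : poch a (n + 1) = poch a n * (a + n) := by
  simp [poch, ascPochhammer_succ_eval]

theorem poch_eq_prod (a : ℂ) (n : ℕ) : poch a n = ∏ j ∈ range n, (a + j) := by
  induction n with
  | zero => simp [poch_zero]
  | succ n ih => rw [poch_succ, prod_range_succ, ih]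

theorem poch_add (a : ℂ) (m n : ℕ) : poch a (m + n) = poch a m * poch (a + m) n := by
  simp only [poch_eq_prod, prod_range_add, Nat.cast_add, add_assoc]

/-- The functional equation of the entire function `1 / Γ`, iterated. It holds at the poles of `Γ`
too, where Mathlib's `Γ` is `0`. -/
theorem inv_Gamma_eq_poch_mul (c : ℂ) (n : ℕ) :
    (Complex.Gamma c)⁻¹ = poch c n * (Complex.Gamma (c + n))⁻¹ := by
  induction n with
  | zero => simp [poch_zero]
  | succ n ih =>
    rw [ih, Complex.one_div_Gamma_eq_self_mul_one_div_Gamma_add_one (c + n), poch_succ]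
    push_cast
    ring_nf

theorem Gamma_add_nat {c : ℂ} (hc : Complex.Gamma c ≠ 0) (n : ℕ) :
    Complex.Gamma (c + n) = Complex.Gamma c * poch c n := by
  have h := inv_Gamma_eq_poch_mul c n
  have h2 : Complex.Gamma (c + n) ≠ 0 := by
    intro h0
    rw [h0] at h
    simp [hc] at h
  field_simp at h
  rw [← h]

theorem poch_ne_zero {c : ℂ} (hc : 0 < c.re) (n : ℕ) : poch c n ≠ 0 := by
  rw [poch_eq_prod, prod_ne_zero_iff]
  intro j _ h
  have := congrArg Complex.re h
  simp at this
  have : (0 : ℝ) ≤ j := j.cast_nonneg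
  linarith

/-- Euler's limit for `Γ`, rewritten as the asymptotics of `Γ` along `c + ℕ`. -/
theorem tendsto_Gamma_add_nat_div (c : ℂ) :
    Tendsto (fun n : ℕ ↦ Complex.Gamma (c + n) / ((n ! : ℂ) * (n : ℂ) ^ (c - 1)))
      atTop (𝓝 1) := by
  -- Downward from the half-plane `Re c > 1`.
  suffices H : ∀ k : ℕ, ∀ c : ℂ, 1 < c.re + k →
      Tendsto (fun n : ℕ ↦ Complex.Gamma (c + n) / ((n ! : ℂ) * (n : ℂ) ^ (c - 1)))
        atTop (𝓝 1) by
    obtain ⟨k, hk⟩ := exists_nat_gt (1 - c.re)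
    exact H k c (by linarith)
  intro k
  induction k with
  | zero =>
    intro c hc
    have hs : 0 < (c - 1).re := by simp at hc ⊢; linarith
    have hΓ := Complex.Gamma_ne_zero_of_re_pos hs
    have h := (Complex.GammaSeq_tendsto_Gamma (c - 1)).inv₀ hΓ |>.const_mul (Complex.Gamma (c - 1))
    rw [mul_inv_cancel₀ hΓ] at h
    refine h.congr' ?_
    filter_upwards [eventually_ge_atTop 1] with n hn
    have h1 : Complex.Gamma (c + n) = Complex.Gamma (c - 1) * poch (c - 1) (n + 1) := by
      rw [← Gamma_add_nat hΓ]
      congr 1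
      push_cast
      ring
    rw [Complex.GammaSeq, h1, poch_eq_prod, inv_div]
    ring
  | succ k ih =>
    intro c hc
    have h := ih (c + 1) (by push_cast at hc; simp; linarith)
    have h2 : Tendsto (fun n : ℕ ↦ (n : ℂ) / (c + n)) atTop (𝓝 1) := by
      have := tendsto_natCast_div_add_atTop (𝕜 := ℂ) c
      simpa [add_comm] using this
    have h3 := h.mul h2
    rw [mul_one] at h3
    refine h3.congr' ?_
    obtain ⟨N, hN⟩ := exists_nat_gt (-c.re)
    filter_upwards [eventually_ge_atTop (N + 1)] with n hn
    have hne : c + n ≠ 0 := by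
      intro h
      have := congrArg Complex.re h
      simp at this
      have : (N : ℝ) + 1 ≤ n := by exact_mod_cast hn
      linarith
    have hn0 : (n : ℂ) ≠ 0 := by norm_cast; omega
    have e1 : Complex.Gamma (c + 1 + n) = (c + n) * Complex.Gamma (c + n) := by
      rw [← Complex.Gamma_add_one _ hne]
      congr 1
      ring
    have e2 : (n : ℂ) ^ (c + 1 - 1) = (n : ℂ) ^ (c - 1) * n := by
      rw [show c + 1 - 1 = (c - 1) + 1 by ring, Complex.cpow_add _ _ hn0, Complex.cpow_one]
    have hn1 : (n : ℂ) ^ (c - 1) ≠ 0 := by simp [Complex.cpow_eq_zero_iff, hn0]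
    have hn2 : (n ! : ℂ) ≠ 0 := by exact_mod_cast n.factorial_ne_zero
    rw [e1, e2]
    field_simp

/-- `n! n ^ (r - 1)`, the order of growth of `(a)_n` and of `Γ(a + n)` for `Re a = r`. -/
noncomputable def pochGrowth (r : ℝ) (n : ℕ) : ℝ := n ! * (n : ℝ) ^ (r - 1)

theorem pochGrowth_pos (r : ℝ) {n : ℕ} (hn : 1 ≤ n) : 0 < pochGrowth r n := by
  have : (0 : ℝ) < n := by exact_mod_cast hn
  have := n.factorial_pos
  unfold pochGrowth
  positivity

theorem norm_pochGrowth_complex (c : ℂ) {n : ℕ} (hn : 1 ≤ n) :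
    ‖(n ! : ℂ) * (n : ℂ) ^ (c - 1)‖ = pochGrowth c.re n := by
  rw [norm_mul, Complex.norm_natCast, Complex.norm_natCast_cpow_of_pos hn]
  simp [pochGrowth]

theorem tendsto_norm_Gamma_add_nat_div (c : ℂ) :
    Tendsto (fun n : ℕ ↦ ‖Complex.Gamma (c + n)‖ / pochGrowth c.re n) atTop (𝓝 1) := by
  have h := (tendsto_Gamma_add_nat_div c).norm
  rw [norm_one] at h
  refine h.congr' ?_
  filter_upwards [eventually_ge_atTop 1] with n hn
  rw [norm_div, norm_pochGrowth_complex c hn]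

theorem isTheta_Gamma_add_nat (c : ℂ) :
    (fun n : ℕ ↦ Complex.Gamma (c + n)) =Θ[atTop] pochGrowth c.re := by
  have h := tendsto_norm_Gamma_add_nat_div c
  have h' : (fun n : ℕ ↦ ‖Complex.Gamma (c + n)‖) ~[atTop] pochGrowth c.re := by
    refine (isEquivalent_iff_tendsto_one ?_).2 h
    filter_upwards [eventually_ge_atTop 1] with n hn
    exact (pochGrowth_pos _ hn).ne'
  exact (isTheta_norm_left.1 h'.isTheta)

theorem isBigO_poch (a : ℂ) : poch a =O[atTop] pochGrowth a.re := by
  by_cases ha : Complex.Gamma a = 0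
  · have : poch a =ᶠ[atTop] fun _ ↦ (0 : ℂ) := by
      rw [Complex.Gamma_eq_zero_iff] at ha
      obtain ⟨m, rfl⟩ := ha
      filter_upwards [eventually_ge_atTop (m + 1)] with n hn
      rw [poch_eq_prod]
      exact prod_eq_zero (mem_range.2 hn) (by simp)
    exact this.trans_isBigO (isBigO_zero _ _)
  · have : poch a = fun n : ℕ ↦ (Complex.Gamma a)⁻¹ * Complex.Gamma (a + n) := by
      ext n
      rw [Gamma_add_nat ha, inv_mul_cancel_left₀ ha]
    rw [this]
    exact (isTheta_Gamma_add_nat a).isBigO.const_mul_left _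

theorem isTheta_poch {a : ℂ} (ha : 0 < a.re) : poch a =Θ[atTop] pochGrowth a.re := by
  have hΓ := Complex.Gamma_ne_zero_of_re_pos ha
  refine ⟨isBigO_poch a, ?_⟩
  have : (fun n : ℕ ↦ Complex.Gamma (a + n)) = fun n : ℕ ↦ Complex.Gamma a * poch a n := by
    ext n
    rw [Gamma_add_nat hΓ]
  exact (isTheta_Gamma_add_nat a).isBigO_symm.trans
    (this ▸ (isBigO_refl _ _).const_mul_left _)

theorem isBigO_inv_Gamma_add_nat (c : ℂ) :
    (fun n : ℕ ↦ (Complex.Gamma (c + n))⁻¹) =O[atTop] fun n ↦ (pochGrowth c.re n)⁻¹ :=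
  (isTheta_Gamma_add_nat c).inv.isBigO

/-- If `g` dominates `f` at infinity and has no zeros, a single constant serves for all indices. -/
theorem exists_norm_le_mul_of_isBigO {f g : ℕ → ℂ} (h : f =O[atTop] g) (hg : ∀ n, g n ≠ 0) :
    ∃ C, 0 < C ∧ ∀ n, ‖f n‖ ≤ C * ‖g n‖ := by
  obtain ⟨C, hC, hb⟩ := bound_of_isBigO_nat_atTop h
  exact ⟨C, hC, fun n ↦ hb (hg n)⟩

theorem pochGrowth_le {r r' : ℝ} (h : r ≤ r') {n : ℕ} (hn : 1 ≤ n) :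
    pochGrowth r n ≤ pochGrowth r' n := by
  unfold pochGrowth
  have : (1 : ℝ) ≤ n := by exact_mod_cast hn
  gcongr

/-- Comparison of Pochhammer symbols with those of a real parameter. -/
theorem exists_norm_poch_le (a : ℂ) {A : ℝ} (hA : 0 < A) (hle : a.re ≤ A) :
    ∃ C, 0 < C ∧ ∀ n, ‖poch a n‖ ≤ C * ‖poch (A : ℂ) n‖ := by
  refine exists_norm_le_mul_of_isBigO ?_ (poch_ne_zero (by simpa using hA))
  have h1 : pochGrowth a.re =O[atTop] pochGrowth A := by
    refine IsBigO.of_bound 1 ?_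
    filter_upwards [eventually_ge_atTop 1] with n hn
    rw [Real.norm_of_nonneg (pochGrowth_pos _ hn).le, Real.norm_of_nonneg (pochGrowth_pos _ hn).le,
      one_mul]
    exact pochGrowth_le hle hn
  have h2 := (isTheta_poch (a := (A : ℂ)) (by simpa using hA)).isBigO_symm
  exact (isBigO_poch a).trans (h1.trans (by simpa using h2))

/-- The opposite comparison needs no constant: `|c + j| ≥ Re c + j` factor by factor. -/
theorem norm_poch_ofReal_re_le {c : ℂ} (hc : 0 < c.re) (n : ℕ) :
    ‖poch (c.re : ℂ) n‖ ≤ ‖poch c n‖ := by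
  rw [poch_eq_prod, poch_eq_prod, norm_prod, norm_prod]
  refine prod_le_prod (fun _ _ ↦ norm_nonneg _) fun j _ ↦ ?_
  have h : ((c.re : ℂ) + j) = ((c.re + j : ℝ) : ℂ) := by push_cast; rfl
  rw [h, Complex.norm_real, Real.norm_of_nonneg (by positivity)]
  simpa using Complex.re_le_norm (c + j)

theorem poch_div_factorial_eq_choose (a : ℂ) (n : ℕ) :
    poch a n / (n ! : ℂ) = Ring.choose (a + n - 1) n := by
  have h : (n ! : ℂ) ≠ 0 := by exact_mod_cast n.factorial_ne_zero
  rw [div_eq_iff h, ← Ring.multichoose_eq, mul_comm, ← nsmul_eq_mul,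
    Ring.factorial_nsmul_multichoose_eq_ascPochhammer, Polynomial.ascPochhammer_smeval_eq_eval, poch]

theorem neg_one_pow_mul_poch_div_factorial (a : ℂ) (n : ℕ) :
    (-1) ^ n * (poch a n / (n ! : ℂ)) = Ring.choose (-a) n := by
  rw [poch_div_factorial_eq_choose, Ring.choose_neg]
  simp [Units.smul_def]

/-- The Chu–Vandermonde identity, in the form in which it turns `(c - b)_i` into `(b)_N`. -/
theorem poch_div_factorial_eq_sum (b c : ℂ) (N : ℕ) :
    poch b N / (N ! : ℂ) =
      ∑ q ∈ antidiagonal N, (-1) ^ q.1 * (poch (c - b) q.1 / (q.1 ! : ℂ)) *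
        (poch (c + q.1) q.2 / (q.2 ! : ℂ)) := by
  rw [poch_div_factorial_eq_choose, show b + N - 1 = -(c - b) + (c + N - 1) by ring,
    Ring.add_choose_eq _ (Commute.all _ _)]
  refine sum_congr rfl fun q hq ↦ ?_
  rw [neg_one_pow_mul_poch_div_factorial, poch_div_factorial_eq_choose]
  have : (N : ℂ) = q.1 + q.2 := by exact_mod_cast (mem_antidiagonal.1 hq).symm
  rw [this, add_assoc]

theorem hasSum_poch_div_factorial_mul_pow (a : ℂ) {x : ℂ} (hx : ‖x‖ < 1) :
    HasSum (fun n : ℕ ↦ poch a n / (n ! : ℂ) * x ^ n) ((1 - x) ^ (-a)) := by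
  have h := (Complex.one_div_one_sub_cpow_hasFPowerSeriesOnBall_zero a).hasSum (y := x) (by
    rw [Metric.mem_eball, edist_zero_right]
    rwa [← ofReal_norm, ENNReal.ofReal_lt_one])
  simp only [zero_add, one_div] at h
  rw [Complex.cpow_neg]
  refine h.congr_fun fun n ↦ ?_
  simp [poch_div_factorial_eq_choose, mul_comm]

theorem norm_poch_le_norm_poch_add {c : ℂ} (hc : 0 ≤ c.re) {t : ℝ} (ht : 0 ≤ t) (n : ℕ) :
    ‖poch c n‖ ≤ ‖poch (c + t) n‖ := by
  rw [poch_eq_prod, poch_eq_prod, norm_prod, norm_prod]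
  refine prod_le_prod (fun _ _ ↦ norm_nonneg _) fun j _ ↦ ?_
  rw [← sq_le_sq₀ (norm_nonneg _) (norm_nonneg _), Complex.sq_norm, Complex.sq_norm,
    Complex.normSq_apply, Complex.normSq_apply]
  have : (0 : ℝ) ≤ j := j.cast_nonneg
  simp
  nlinarith

theorem tendsto_inv_poch_add_nat (c : ℂ) {n : ℕ} (hn : n ≠ 0) :
    Tendsto (fun N : ℕ ↦ (poch (c + N) n)⁻¹) atTop (𝓝 0) := by
  have h : Tendsto (fun N : ℕ ↦ ∏ j ∈ range n, (c + N + j)⁻¹) atTop (𝓝 (∏ j ∈ range n, 0)) := by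
    refine tendsto_finsetProd _ fun j _ ↦ ?_
    refine tendsto_inv₀_cobounded.comp ?_
    have h1 : Tendsto (fun N : ℕ ↦ (N : ℂ)) atTop (Bornology.cobounded ℂ) :=
      tendsto_norm_atTop_iff_cobounded.1 (by simpa using tendsto_natCast_atTop_atTop)
    refine (tendsto_add_const_cobounded (c + j) |>.comp h1).congr fun N ↦ ?_
    simp only [Function.comp]
    ring
  simpa [poch_eq_prod, hn] using h

/-! ### Gauss's summation theorem -/

/-- The `n`-th term of the hypergeometric series `₂F₁(a, b; c; 1) / Γ(c)`. -/
noncomputable def gaussTerm (a b c : ℂ) (n : ℕ) : ℂ :=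
  poch a n * poch b n / ((n ! : ℂ) * Complex.Gamma (c + n))

theorem gaussTerm_isBigO (a b c : ℂ) :
    gaussTerm a b c =O[atTop] fun n : ℕ ↦ (n : ℝ) ^ ((a + b - c).re - 1) := by
  have h0 : (fun n : ℕ ↦ ((n ! : ℂ))⁻¹) =O[atTop] fun n : ℕ ↦ ((n ! : ℝ))⁻¹ :=
    IsBigO.of_bound 1 (Eventually.of_forall fun n ↦ by simp)
  have h := ((isBigO_poch a).mul (isBigO_poch b)).mul (h0.mul (isBigO_inv_Gamma_add_nat c))
  refine (h.congr_left fun n ↦ ?_).trans_eventuallyEq ?_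
  · rw [gaussTerm, div_eq_mul_inv, mul_inv]
  · filter_upwards [eventually_ge_atTop 1] with n hn
    have hn' : (0 : ℝ) < n := by exact_mod_cast hn
    have hf : (n ! : ℝ) ≠ 0 := by exact_mod_cast n.factorial_ne_zero
    have e : (n : ℝ) ^ ((a + b - c).re - 1) =
        (n : ℝ) ^ (a.re - 1) * (n : ℝ) ^ (b.re - 1) * ((n : ℝ) ^ (c.re - 1))⁻¹ := by
      rw [← Real.rpow_neg hn'.le, ← Real.rpow_add hn', ← Real.rpow_add hn']
      congr 1
      simp
      ring
    rw [e]
    simp only [pochGrowth]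
    have := (Real.rpow_pos_of_pos hn' (c.re - 1)).ne'
    field_simp

theorem summable_norm_gaussTerm {a b c : ℂ} (h : 0 < (c - a - b).re) :
    Summable fun n ↦ ‖gaussTerm a b c n‖ := by
  refine summable_of_isBigO_nat (Real.summable_nat_rpow.2 ?_) (gaussTerm_isBigO a b c).norm_left
  simp at h ⊢
  linarith

theorem gaussTerm_eq_mul (a b c : ℂ) (n : ℕ) :
    gaussTerm a b c n = (c + n) * gaussTerm a b (c + 1) n := by
  simp only [gaussTerm, div_eq_mul_inv, mul_inv]
  rw [Complex.one_div_Gamma_eq_self_mul_one_div_Gamma_add_one (c + n),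
    show c + n + 1 = c + 1 + n by ring]
  ring

/-- The contiguous relation `c ↦ c + 1` for the sum of Gauss's series: the difference of the two
sides telescopes, with `n ↦ n * gaussTerm a b c n`. -/
theorem tsum_gaussTerm_contiguous {a b c : ℂ} (h : 0 < (c - a - b).re) :
    (c - a - b) * ∑' n, gaussTerm a b c n =
      (c - a) * (c - b) * ∑' n, gaussTerm a b (c + 1) n := by
  have s1 := (summable_norm_gaussTerm h).of_norm
  have s2 : Summable (gaussTerm a b (c + 1)) :=
    (summable_norm_gaussTerm (by simp at h ⊢; linarith)).of_norm
  have hd : ∀ n : ℕ, (c - a - b) * gaussTerm a b c n - (c - a) * (c - b) * gaussTerm a b (c + 1) n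
      = n * gaussTerm a b c n - ((n + 1 : ℕ) : ℂ) * gaussTerm a b c (n + 1) := by
    intro n
    have e : ((n + 1 : ℕ) : ℂ) * gaussTerm a b c (n + 1) =
        (a + n) * (b + n) * gaussTerm a b (c + 1) n := by
      have hn : (n : ℂ) + 1 ≠ 0 := by exact_mod_cast n.succ_ne_zero
      rw [gaussTerm, gaussTerm, poch_succ, poch_succ, Nat.factorial_succ]
      push_cast
      rw [show c + (n + 1 : ℂ) = c + 1 + n by ring, mul_assoc ((n : ℂ) + 1),
        ← mul_div_assoc, mul_div_mul_left _ _ hn]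
      ring
    rw [e, gaussTerm_eq_mul]
    ring
  have hlim : Tendsto (fun n : ℕ ↦ (n : ℂ) * gaussTerm a b c n) atTop (𝓝 0) := by
    have h1 : (fun n : ℕ ↦ (n : ℂ) * gaussTerm a b c n) =O[atTop]
        fun n : ℕ ↦ (n : ℝ) ^ (-(c - a - b).re) := by
      have h0 : (fun n : ℕ ↦ (n : ℂ)) =O[atTop] fun n : ℕ ↦ (n : ℝ) :=
        IsBigO.of_bound 1 (Eventually.of_forall fun n ↦ by simp)
      refine (h0.mul (gaussTerm_isBigO a b c)).trans_eventuallyEq ?_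
      filter_upwards [eventually_ge_atTop 1] with n hn
      have hn' : (n : ℝ) ≠ 0 := by norm_cast; omega
      rw [mul_comm, ← Real.rpow_add_one hn']
      congr 1
      simp
      ring
    exact h1.trans_tendsto ((tendsto_rpow_neg_atTop h).comp tendsto_natCast_atTop_atTop)
  have t1 : HasSum (fun n : ℕ ↦ (n : ℂ) * gaussTerm a b c n -
      ((n + 1 : ℕ) : ℂ) * gaussTerm a b c (n + 1)) 0 := by
    have hs : Summable (fun n : ℕ ↦ (n : ℂ) * gaussTerm a b c n -
        ((n + 1 : ℕ) : ℂ) * gaussTerm a b c (n + 1)) :=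
      ((s1.mul_left (c - a - b)).sub (s2.mul_left ((c - a) * (c - b)))).congr hd
    rw [hs.hasSum_iff_tendsto_nat]
    have := hlim.const_sub 0
    simp only [sub_zero] at this
    refine this.congr fun n ↦ ?_
    rw [sum_range_sub' (fun n : ℕ ↦ (n : ℂ) * gaussTerm a b c n)]
    simp
  have := ((s1.hasSum.mul_left (c - a - b)).sub
    (s2.hasSum.mul_left ((c - a) * (c - b)))).unique (t1.congr_fun hd)
  exact sub_eq_zero.1 this

theorem Gamma_add_nat_ne_zero {c : ℂ} {N : ℕ} (h : 0 < c.re + N) : Complex.Gamma (c + N) ≠ 0 :=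
  Complex.Gamma_ne_zero_of_re_pos (by simpa using h)

/-- For `c → ∞` along `c + ℕ`, only the first term of `₂F₁(a, b; c; 1)` survives. -/
theorem tendsto_Gamma_mul_tsum_gaussTerm (a b c : ℂ) :
    Tendsto (fun N : ℕ ↦ Complex.Gamma (c + N) * ∑' n, gaussTerm a b (c + N) n) atTop (𝓝 1) := by
  obtain ⟨M, hM⟩ := exists_nat_gt (max (-c.re) ((a + b - c).re))
  have hM1 : 0 < c.re + M := by linarith [le_max_left (-c.re) ((a + b - c).re)]
  have hM2 : 0 < (c + M - a - b).re := by
    have := le_max_right (-c.re) ((a + b - c).re)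
    simp at this hM ⊢
    linarith
  have key : ∀ N : ℕ, M ≤ N → ∀ n, Complex.Gamma (c + N) * gaussTerm a b (c + N) n =
      poch a n * poch b n / ((n ! : ℂ) * poch (c + N) n) := by
    intro N hN n
    have hN' : (M : ℝ) ≤ N := by exact_mod_cast hN
    have hΓ : Complex.Gamma (c + N) ≠ 0 := Gamma_add_nat_ne_zero (by linarith)
    rw [gaussTerm, Gamma_add_nat hΓ]
    have hp : poch (c + N) n ≠ 0 := poch_ne_zero (by simp; linarith) n
    have : (n ! : ℂ) ≠ 0 := by exact_mod_cast n.factorial_ne_zero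
    field_simp
  have hlim : Tendsto (fun N : ℕ ↦ ∑' n, Complex.Gamma (c + N) * gaussTerm a b (c + N) n) atTop
      (𝓝 (∑' n, if n = 0 then 1 else 0)) := by
    refine tendsto_tsum_of_dominated_convergence
      (bound := fun n ↦ ‖Complex.Gamma (c + M)‖ * ‖gaussTerm a b (c + M) n‖)
      ((summable_norm_gaussTerm hM2).mul_left _) ?_ ?_
    · intro n
      by_cases hn : n = 0
      · subst hn
        refine tendsto_const_nhds.congr' ?_
        filter_upwards [eventually_ge_atTop M] with N hN
        rw [key N hN]
        simp [poch_zero]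
      · rw [if_neg hn]
        have := (tendsto_inv_poch_add_nat c hn).const_mul (poch a n * poch b n / (n ! : ℂ))
        rw [mul_zero] at this
        refine this.congr' ?_
        filter_upwards [eventually_ge_atTop M] with N hN
        rw [key N hN, div_mul_eq_div_div, ← div_eq_mul_inv]
    · filter_upwards [eventually_ge_atTop M] with N hN n
      rw [← norm_mul, key N hN, key M le_rfl, norm_div, norm_div]
      have hpos : 0 < ‖poch (c + M) n‖ := norm_pos_iff.2 (poch_ne_zero (by simpa using hM1) n)
      have hf : 0 < ‖(n ! : ℂ)‖ := norm_pos_iff.2 (by exact_mod_cast n.factorial_ne_zero)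
      have hle : ‖poch (c + M) n‖ ≤ ‖poch (c + N) n‖ := by
        have := norm_poch_le_norm_poch_add (c := c + M) (by simpa using hM1.le)
          (t := N - M) (by simpa using hN) n
        simpa using this
      simp only [norm_mul]
      gcongr
  rw [tsum_ite_eq] at hlim
  simpa only [tsum_mul_left] using hlim

theorem tsum_gaussTerm_eq_poch_mul {a b c : ℂ} (h : 0 < (c - a - b).re) (N : ℕ) :
    ∑' n, gaussTerm a b c n =
      poch (c - a) N * poch (c - b) N / poch (c - a - b) N * ∑' n, gaussTerm a b (c + N) n := by
  induction N with
  | zero => simp [poch_zero]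
  | succ N ih =>
    have hre : 0 < (c + N - a - b).re := by
      have : (0 : ℝ) ≤ N := N.cast_nonneg
      simp at h ⊢
      linarith
    have h1 := tsum_gaussTerm_contiguous hre
    have hne : c + N - a - b ≠ 0 := fun h0 ↦ by simp [h0] at hre
    have hp := poch_ne_zero h N
    have hp' := poch_ne_zero h (N + 1)
    rw [ih, poch_succ, poch_succ]
    rw [div_mul_eq_mul_div, div_mul_eq_mul_div, div_eq_div_iff hp hp', poch_succ,
      show c - a - b + (N : ℂ) = c + N - a - b by ring]
    have e : ∑' n, gaussTerm a b (c + ((N + 1 : ℕ) : ℂ)) n = ∑' n, gaussTerm a b (c + N + 1) n := by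
      push_cast
      simp only [add_assoc]
    rw [e]
    linear_combination poch (c - a) N * poch (c - b) N * poch (c - a - b) N * h1

theorem eventually_Gamma_add_nat_ne_zero (c : ℂ) :
    ∀ᶠ N : ℕ in atTop, Complex.Gamma (c + N) ≠ 0 := by
  obtain ⟨M, hM⟩ := exists_nat_gt (-c.re)
  filter_upwards [eventually_ge_atTop M] with N hN
  have : (M : ℝ) ≤ N := by exact_mod_cast hN
  exact Gamma_add_nat_ne_zero (by linarith)

/-- **Gauss's summation theorem**, regularized so that no condition on `c` is needed. -/
theorem hasSum_gaussTerm {a b c : ℂ} (h : 0 < (c - a - b).re) :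
    HasSum (gaussTerm a b c)
      (Complex.Gamma (c - a - b) / (Complex.Gamma (c - a) * Complex.Gamma (c - b))) := by
  rw [(summable_norm_gaussTerm h).of_norm.hasSum_iff]
  have hlim : Tendsto (fun N : ℕ ↦ (Complex.Gamma (c - a - b) /
      (Complex.Gamma (c - a) * Complex.Gamma (c - b)) *
      (Complex.Gamma (c - a + N) * Complex.Gamma (c - b + N) /
        (Complex.Gamma (c - a - b + N) * Complex.Gamma (c + N)))) *
      (Complex.Gamma (c + N) * ∑' n, gaussTerm a b (c + N) n)) atTop
      (𝓝 (Complex.Gamma (c - a - b) / (Complex.Gamma (c - a) * Complex.Gamma (c - b)) *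
        (1 * 1 / (1 * 1)) * 1)) := by
    refine Tendsto.mul (Tendsto.const_mul _ ?_) (tendsto_Gamma_mul_tsum_gaussTerm a b c)
    refine ((((tendsto_Gamma_add_nat_div (c - a)).mul (tendsto_Gamma_add_nat_div (c - b))).div
      ((tendsto_Gamma_add_nat_div (c - a - b)).mul (tendsto_Gamma_add_nat_div c))
      (by simp))).congr' ?_
    filter_upwards [eventually_ge_atTop 1, eventually_Gamma_add_nat_ne_zero (c - a - b),
      eventually_Gamma_add_nat_ne_zero c] with n hn h1 h2
    have hn0 : (n : ℂ) ≠ 0 := by norm_cast; omega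
    have hf : (n ! : ℂ) ≠ 0 := by exact_mod_cast n.factorial_ne_zero
    have hp : (n : ℂ) ^ (c - a - 1) * (n : ℂ) ^ (c - b - 1) =
        (n : ℂ) ^ (c - a - b - 1) * (n : ℂ) ^ (c - 1) := by
      rw [← Complex.cpow_add _ _ hn0, ← Complex.cpow_add _ _ hn0]
      congr 1
      ring
    have hnz : ∀ z : ℂ, (n : ℂ) ^ z ≠ 0 := fun z ↦ by simp [Complex.cpow_eq_zero_iff, hn0]
    have a1 := hnz (c - a - 1)
    have a2 := hnz (c - b - 1)
    have a3 := hnz (c - a - b - 1)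
    have a4 := hnz (c - 1)
    simp only [Pi.div_apply]
    rw [div_mul_div_comm, div_mul_div_comm, div_div_div_eq,
      div_eq_div_iff (by positivity) (by positivity)]
    linear_combination (-Complex.Gamma (c - a + n) * Complex.Gamma (c - b + n) *
      Complex.Gamma (c - a - b + n) * Complex.Gamma (c + n) * (n ! : ℂ) ^ 2) * hp
  rw [mul_one, one_mul, div_one, mul_one] at hlim
  refine tendsto_nhds_unique (tendsto_const_nhds.congr' ?_) hlim
  filter_upwards [eventually_Gamma_add_nat_ne_zero (c - a), eventually_Gamma_add_nat_ne_zero (c - b),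
    eventually_Gamma_add_nat_ne_zero c] with N h1 h2 h3
  have hΓ := Complex.Gamma_ne_zero_of_re_pos h
  have hp := poch_ne_zero h N
  rw [tsum_gaussTerm_eq_poch_mul h N, ← mul_assoc]
  congr 1
  rw [div_eq_mul_inv (Complex.Gamma (c - a - b)), mul_inv, inv_Gamma_eq_poch_mul (c - a) N,
    inv_Gamma_eq_poch_mul (c - b) N, Gamma_add_nat hΓ]
  field_simp

/-! ### The double series and its sum -/

theorem poch_ofReal (a : ℝ) (n : ℕ) : poch (a : ℂ) n = ((∏ j ∈ range n, (a + j) : ℝ) : ℂ) := by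
  simp [poch_eq_prod]

/-- For real parameters the terms of Gauss's series are positive, so that its sum is also the sum of
the norms. -/
theorem hasSum_norm_gaussTerm_ofReal {a b c : ℝ} (ha : 0 < a) (hb : 0 < b) (h : a + b < c) :
    HasSum (fun n ↦ ‖gaussTerm a b c n‖)
      (Real.Gamma (c - a - b) / (Real.Gamma (c - a) * Real.Gamma (c - b))) := by
  have h1 := hasSum_gaussTerm (a := a) (b := b) (c := c) (by simp; linarith)
  rw [← Complex.hasSum_ofReal]
  convert h1 using 1
  · funext n
    have e : gaussTerm a b c n = (((∏ j ∈ range n, (a + j)) * (∏ j ∈ range n, (b + j)) /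
        (n ! * Real.Gamma (c + n)) : ℝ) : ℂ) := by
      rw [gaussTerm, poch_ofReal, poch_ofReal]
      push_cast
      rw [← Complex.Gamma_ofReal]
      push_cast
      rfl
    have hc : 0 < c := by linarith
    have hΓ : 0 < Real.Gamma (c + n) := Real.Gamma_pos_of_pos (by positivity)
    rw [e, Complex.norm_real, Real.norm_of_nonneg]
    have : 0 < ∏ j ∈ range n, (a + j) := prod_pos fun j _ ↦ by positivity
    have : 0 < ∏ j ∈ range n, (b + j) := prod_pos fun j _ ↦ by positivity
    positivity
  · push_cast [← Complex.Gamma_ofReal]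
    rfl

theorem realGamma_add_nat {r : ℝ} (hr : 0 < r) (n : ℕ) :
    Real.Gamma (r + n) = Real.Gamma r * ‖poch (r : ℂ) n‖ := by
  have hΓr : Complex.Gamma (r : ℂ) ≠ 0 := Complex.Gamma_ne_zero_of_re_pos (by simpa using hr)
  have := congrArg norm (Gamma_add_nat hΓr n)
  rw [norm_mul, Complex.Gamma_ofReal, Complex.norm_real,
    Real.norm_of_nonneg (Real.Gamma_pos_of_pos hr).le] at this
  rw [← this, ← Complex.ofReal_natCast, ← Complex.ofReal_add, Complex.Gamma_ofReal,
    Complex.norm_real, Real.norm_of_nonneg (Real.Gamma_pos_of_pos (by positivity)).le]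

/-- `|Γ|` along `c + ℕ` is comparable from below with `Γ` along `Re c + ℕ`. -/
theorem exists_inv_norm_Gamma_le {c : ℂ} (hc : 0 < c.re) :
    ∃ C, 0 < C ∧ ∀ n : ℕ, ‖Complex.Gamma (c + n)‖⁻¹ ≤ C * (Real.Gamma (c.re + n))⁻¹ := by
  have hΓ := Complex.Gamma_ne_zero_of_re_pos hc
  have hR := Real.Gamma_pos_of_pos hc
  refine ⟨Real.Gamma c.re / ‖Complex.Gamma c‖, by positivity, fun n ↦ ?_⟩
  have hp : 0 < ‖poch (c.re : ℂ) n‖ := norm_pos_iff.2 (poch_ne_zero (by simpa using hc) n)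
  have hp' : 0 < ‖poch c n‖ := norm_pos_iff.2 (poch_ne_zero hc n)
  rw [realGamma_add_nat hc, Gamma_add_nat hΓ, norm_mul, mul_inv, mul_inv]
  have : Real.Gamma c.re / ‖Complex.Gamma c‖ * ((Real.Gamma c.re)⁻¹ * ‖poch (c.re : ℂ) n‖⁻¹) =
      ‖Complex.Gamma c‖⁻¹ * ‖poch (c.re : ℂ) n‖⁻¹ := by
    field_simp
  rw [this]
  have := norm_poch_ofReal_re_le hc n
  gcongr

/-- Comparison of `(d + m)_n` with `(Re d + m)_n`, uniformly in both `m` and `n`. -/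
theorem exists_norm_poch_add_le {d : ℂ} (hd : 0 < d.re) :
    ∃ C, 0 < C ∧ ∀ m n : ℕ, ‖poch (d + m) n‖ ≤ C * ‖poch ((d.re + m : ℝ) : ℂ) n‖ := by
  obtain ⟨C, hC, h⟩ := exists_norm_poch_le d hd le_rfl
  refine ⟨C, hC, fun m n ↦ ?_⟩
  have hr : 0 < ((d.re : ℂ)).re := by simpa using hd
  have hp : 0 < ‖poch (d.re : ℂ) m‖ := norm_pos_iff.2 (poch_ne_zero hr m)
  have hp' : 0 < ‖poch d m‖ := norm_pos_iff.2 (poch_ne_zero hd m)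
  have h1 := h (m + n)
  rw [poch_add, poch_add, norm_mul, norm_mul] at h1
  have h2 := norm_poch_ofReal_re_le hd m
  push_cast
  refine le_of_mul_le_mul_left ?_ hp
  calc ‖poch (d.re : ℂ) m‖ * ‖poch (d + m) n‖ ≤ ‖poch d m‖ * ‖poch (d + m) n‖ := by gcongr
    _ ≤ _ := h1
    _ = _ := by ring

theorem HasSum.sum_antidiagonal {F : ℕ × ℕ → ℂ} {a : ℂ} (h : HasSum F a) :
    HasSum (fun N ↦ ∑ q ∈ antidiagonal N, F q) a := by
  have h1 := (HasAntidiagonal.sigmaAntidiagonalEquivProd :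
    (Σ n : ℕ, antidiagonal n) ≃ ℕ × ℕ).hasSum_iff.2 h
  refine h1.sigma fun N ↦ ?_
  have := hasSum_fintype (fun q : antidiagonal N ↦ F q)
  rwa [sum_coe_sort (antidiagonal N) F] at this

theorem Summable.sum_antidiagonal {F : ℕ × ℕ → ℝ} (h : Summable F) :
    Summable (fun N ↦ ∑ q ∈ antidiagonal N, F q) := by
  have h1 := ((HasAntidiagonal.sigmaAntidiagonalEquivProd :
    (Σ n : ℕ, antidiagonal n) ≃ ℕ × ℕ).summable_iff.2 h).sigma
  refine h1.congr fun N ↦ ?_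
  simp only [Function.comp, HasAntidiagonal.sigmaAntidiagonalEquivProd_apply, tsum_fintype]
  exact (sum_coe_sort (antidiagonal N) F)

/-- The terms of the double series whose diagonal sums are the numbers `norlundCoeff`. -/
noncomputable def norlundTerm (α α' β β' γ : ℂ) (q : ℕ × ℕ) : ℂ :=
  poch α q.1 * poch β q.1 / (q.1 ! : ℂ) * (poch α' q.2 * poch (γ - β' + q.1) q.2 / (q.2 ! : ℂ))

/-- The coefficients in
`t ^ (-α') F₃(α, α', β, β'; γ; 1 - t/x, 1 - x/t) =
  x ^ (-α') ∑ N, norlundCoeff α α' β β' γ N / (γ)_N * (1 - t/x) ^ N`. -/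
noncomputable def norlundCoeff (α α' β β' γ : ℂ) (N : ℕ) : ℂ :=
  ∑ q ∈ antidiagonal N, norlundTerm α α' β β' γ q

/-- The quotient of Gamma functions that is the Mellin transform of the kernel of the fractional
integral, up to the factor `Γ(s) Γ(γ)` and a power of `x`. -/
noncomputable def norlundProd (α α' β β' γ s : ℂ) : ℂ :=
  Complex.Gamma (s + β' - α') * Complex.Gamma (s + γ - α - α' - β) /
    (Complex.Gamma (s + β') * Complex.Gamma (s + γ - α - α') * Complex.Gamma (s + γ - α' - β))

/-- Absolute convergence of the double series. The inner sums are compared with Gauss's series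
with the real parameter `A` in place of `α'`, which is why `A` has to be positive. -/
theorem summable_norm_norlundTerm_div {α α' β β' γ s : ℂ} {A : ℝ} (hA : 0 < A) (hα' : α'.re ≤ A)
    (h0 : 0 < (γ + s).re) (h1 : A < (s + β').re) (h2 : A < (s + γ - α - β).re) :
    Summable fun q : ℕ × ℕ ↦
      ‖norlundTerm α α' β β' γ q‖ / Real.Gamma ((γ + s).re + (q.1 + q.2 : ℕ)) := by
  set r := (γ + s).re with hr
  have hΓ : ∀ m n : ℕ, 0 < Real.Gamma (r + (m + n : ℕ)) := fun m n ↦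
    Real.Gamma_pos_of_pos (by positivity)
  have hrow : ∀ m n : ℕ, ‖norlundTerm α α' β β' γ (m, n)‖ / Real.Gamma (r + (m + n : ℕ)) =
      ‖poch α m * poch β m / (m ! : ℂ)‖ *
        ‖gaussTerm α' (γ - β' + m) ((r + m : ℝ) : ℂ) n‖ := by
    intro m n
    have e : Complex.Gamma (((r + m : ℝ) : ℂ) + n) = ((Real.Gamma (r + (m + n : ℕ)) : ℝ) : ℂ) := by
      rw [← Complex.Gamma_ofReal]
      push_cast
      rw [add_assoc]
    rw [norlundTerm, norm_mul, gaussTerm, e, norm_div (poch α' n * _), norm_div (poch α' n * _),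
      norm_mul (n ! : ℂ), Complex.norm_real, Real.norm_of_nonneg (hΓ m n).le, mul_div_assoc,
      div_div]
  rw [summable_prod_of_nonneg (fun q ↦ div_nonneg (norm_nonneg _) (hΓ _ _).le)]
  simp only [hrow, tsum_mul_left]
  have hre : ∀ m : ℕ, 0 < (((r + m : ℝ) : ℂ) - α' - (γ - β' + m)).re := by
    intro m
    simp [hr] at h1 ⊢
    linarith
  refine ⟨fun m ↦ (summable_norm_gaussTerm (hre m)).mul_left _, ?_⟩
  -- The comparison with real parameters needs `Re (γ - β' + m) > 0`, that is, `m ≥ M`.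
  obtain ⟨M, hM⟩ := exists_nat_gt (-(γ - β').re)
  have hd : 0 < (γ - β' + M).re := by
    rw [Complex.add_re, Complex.natCast_re]
    linarith
  obtain ⟨C, hC, hCb⟩ := exists_norm_poch_add_le hd
  obtain ⟨C', hC', hCb'⟩ := exists_norm_poch_le α' hA hα'
  set B := (γ - β').re with hB
  have hrAB : A + B < r := by
    simp [hB, hr] at h1 ⊢
    linarith
  have hsum : Summable fun m ↦ ‖gaussTerm α β ((r - A : ℝ) : ℂ) m‖ :=
    summable_norm_gaussTerm (by simp [hr] at h2 ⊢; linarith)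
  refine Summable.of_norm_bounded_eventually_nat
    (hsum.mul_left (C * C' * (Real.Gamma (r - A - B) / ‖Real.Gamma (r - B)‖))) ?_
  filter_upwards [eventually_ge_atTop M] with m hm
  obtain ⟨j, rfl⟩ := Nat.exists_eq_add_of_le hm
  have hBm : 0 < B + (M + j : ℕ) := by
    push_cast
    have : (0 : ℝ) ≤ j := j.cast_nonneg
    linarith
  have hg := hasSum_norm_gaussTerm_ofReal (c := r + (M + j : ℕ)) hA hBm (by linarith)
  have hbound : ∑' n, ‖gaussTerm α' (γ - β' + (M + j : ℕ)) ((r + (M + j : ℕ) : ℝ) : ℂ) n‖ ≤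
      C * C' * (Real.Gamma (r + (M + j : ℕ) - A - (B + (M + j : ℕ))) /
        (Real.Gamma (r + (M + j : ℕ) - A) * Real.Gamma (r + (M + j : ℕ) - (B + (M + j : ℕ))))) := by
    rw [← (hg.mul_left (C * C')).tsum_eq]
    refine (summable_norm_gaussTerm (hre _)).tsum_le_tsum (fun n ↦ ?_)
      (hg.mul_left (C * C')).summable
    have e1 := hCb j n
    have e2 := hCb' n
    have e3 : γ - β' + ((M + j : ℕ) : ℂ) = γ - β' + M + j := by push_cast; ring
    have e4 : (γ - β' + M).re + j = B + (M + j : ℕ) := by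
      rw [Complex.add_re, Complex.natCast_re, ← hB]; push_cast; ring
    rw [e4] at e1
    rw [gaussTerm, gaussTerm, e3, norm_div, norm_div, norm_mul (poch _ _), norm_mul (poch _ _),
      ← mul_div_assoc]
    gcongr ?_ / _
    calc _ ≤ (C' * ‖poch (A : ℂ) n‖) * (C * ‖poch ((B + (M + j : ℕ) : ℝ) : ℂ) n‖) := by gcongr
      _ = _ := by ring
  rw [Real.norm_of_nonneg (mul_nonneg (norm_nonneg _) (tsum_nonneg fun _ ↦ norm_nonneg _))]
  refine (mul_le_mul_of_nonneg_left hbound (norm_nonneg _)).trans_eq ?_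
  have hg2 : 0 < Real.Gamma (r - B) := Real.Gamma_pos_of_pos (by linarith)
  have hg3 : 0 < Real.Gamma (r - A + (M + j : ℕ)) := Real.Gamma_pos_of_pos (by linarith)
  have e5 : Complex.Gamma (((r - A : ℝ) : ℂ) + (M + j : ℕ)) =
      ((Real.Gamma (r - A + (M + j : ℕ)) : ℝ) : ℂ) := by
    rw [← Complex.Gamma_ofReal]
    push_cast
    rfl
  rw [gaussTerm, e5, norm_div, norm_div, norm_mul ((M + j) ! : ℂ), Complex.norm_real,
    Real.norm_of_nonneg hg2.le, Real.norm_of_nonneg hg3.le,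
    show r + (M + j : ℕ) - A - (B + (M + j : ℕ)) = r - A - B by ring,
    show r + (M + j : ℕ) - A = r - A + (M + j : ℕ) by ring,
    show r + (M + j : ℕ) - (B + (M + j : ℕ)) = r - B by ring]
  have : 0 < ‖((M + j) ! : ℂ)‖ := norm_pos_iff.2 (by exact_mod_cast (M + j).factorial_ne_zero)
  field_simp

theorem summable_norm_norlundCoeff_div {α α' β β' γ s : ℂ} {A : ℝ} (hA : 0 < A) (hα' : α'.re ≤ A)
    (h0 : 0 < (γ + s).re) (h1 : A < (s + β').re) (h2 : A < (s + γ - α - β).re) :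
    Summable fun N : ℕ ↦ ‖norlundCoeff α α' β β' γ N‖ / Real.Gamma ((γ + s).re + N) := by
  refine (summable_norm_norlundTerm_div hA hα' h0 h1 h2).sum_antidiagonal.of_nonneg_of_le
    (fun N ↦ div_nonneg (norm_nonneg _) (Real.Gamma_pos_of_pos (by positivity)).le) fun N ↦ ?_
  have hΓ : 0 < Real.Gamma ((γ + s).re + N) := Real.Gamma_pos_of_pos (by positivity)
  rw [sum_congr rfl fun q hq ↦ by rw [mem_antidiagonal.1 hq], ← sum_div, norlundCoeff]
  gcongr
  exact norm_sum_le _ _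

/-- Summing first over `n` and then over `m`, Gauss's theorem applies twice. -/
theorem hasSum_norlundCoeff_div {α α' β β' γ s : ℂ} {A : ℝ} (hA : 0 < A) (hα' : α'.re ≤ A)
    (h0 : 0 < (γ + s).re) (h1 : A < (s + β').re) (h2 : A < (s + γ - α - β).re) :
    HasSum (fun N : ℕ ↦ norlundCoeff α α' β β' γ N / Complex.Gamma (γ + s + N))
      (norlundProd α α' β β' γ s) := by
  have hs : Summable fun q : ℕ × ℕ ↦
      norlundTerm α α' β β' γ q / Complex.Gamma (γ + s + (q.1 + q.2 : ℕ)) := by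
    obtain ⟨C, hC, hb⟩ := exists_inv_norm_Gamma_le h0
    refine Summable.of_norm_bounded
      ((summable_norm_norlundTerm_div hA hα' h0 h1 h2).mul_left C) fun q ↦ ?_
    rw [norm_div, div_eq_mul_inv, div_eq_mul_inv, mul_left_comm]
    exact mul_le_mul_of_nonneg_left (hb _) (norm_nonneg _)
  have hrow : ∀ m, HasSum (fun n : ℕ ↦
      norlundTerm α α' β β' γ (m, n) / Complex.Gamma (γ + s + (m + n : ℕ)))
      (Complex.Gamma (s + β' - α') / Complex.Gamma (s + β') *
        gaussTerm α β (γ + s - α') m) := by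
    intro m
    have hg := (hasSum_gaussTerm (a := α') (b := γ - β' + m) (c := γ + s + m) (by
      simp at h1 ⊢; linarith)).mul_left (poch α m * poch β m / (m ! : ℂ))
    have e : Complex.Gamma (s + β' - α') / Complex.Gamma (s + β') *
        gaussTerm α β (γ + s - α') m = poch α m * poch β m / (m ! : ℂ) *
        (Complex.Gamma (γ + s + m - α' - (γ - β' + m)) / (Complex.Gamma (γ + s + m - α') *
          Complex.Gamma (γ + s + m - (γ - β' + m)))) := by
      rw [gaussTerm, show γ + s + m - α' - (γ - β' + m) = s + β' - α' by ring,
        show γ + s + m - (γ - β' + m) = s + β' by ring,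
        show γ + s + (m : ℂ) - α' = γ + s - α' + m by ring]
      simp only [div_eq_mul_inv, mul_inv]
      ring
    rw [e]
    refine hg.congr_fun fun n ↦ ?_
    rw [norlundTerm, gaussTerm]
    push_cast
    rw [add_assoc (γ + s), div_mul_eq_div_div]
    ring
  have houter := (hasSum_gaussTerm (a := α) (b := β) (c := γ + s - α') (by
    simp at h2 ⊢; linarith)).mul_left (Complex.Gamma (s + β' - α') / Complex.Gamma (s + β'))
  have hval := (hs.hasSum.prod_fiberwise hrow).unique houter
  have h := hs.hasSum.sum_antidiagonal
  rw [hval] at h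
  convert h using 1
  · funext N
    rw [norlundCoeff, sum_div]
    exact sum_congr rfl fun q hq ↦ by rw [mem_antidiagonal.1 hq]
  · rw [norlundProd, show γ + s - α' - α - β = s + γ - α - α' - β by ring,
      show γ + s - α' - α = s + γ - α - α' by ring, show γ + s - α' - β = s + γ - α' - β by ring]
    simp only [div_eq_mul_inv, mul_inv]
    ring

/-- Uniqueness of the coefficients of an inverse factorial series. -/
theorem eq_zero_of_tsum_div_Gamma_eq_zero {d : ℕ → ℂ} {c : ℂ} (hc : 0 < c.re)
    (hs : Summable fun k ↦ ‖d k / Complex.Gamma (c + k)‖)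
    (h : ∀ M : ℕ, ∑' k, d k / Complex.Gamma (c + M + k) = 0) (N : ℕ) : d N = 0 := by
  induction N using Nat.strong_induction_on with
  | _ N ih =>
  have hre : ∀ M k : ℕ, 0 < (c + M + k).re := by
    intro M k
    simp
    positivity
  have key : ∀ M k : ℕ, Complex.Gamma (c + M + N) * (d k / Complex.Gamma (c + M + k)) =
      d k * (poch (c + N + M) (k - N))⁻¹ := by
    intro M k
    rcases lt_or_ge k N with hk | hk
    · simp [ih k hk]
    · obtain ⟨j, rfl⟩ := Nat.exists_eq_add_of_le hk
      have hΓ := Complex.Gamma_ne_zero_of_re_pos (hre M N)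
      have e : c + M + ((N + j : ℕ) : ℂ) = c + M + N + j := by push_cast; ring
      rw [e, Gamma_add_nat hΓ, Nat.add_sub_cancel_left, show c + N + M = c + M + (N : ℂ) by ring]
      field_simp
  have hlim : Tendsto (fun M : ℕ ↦ ∑' k, Complex.Gamma (c + M + N) *
      (d k / Complex.Gamma (c + M + k))) atTop (𝓝 (∑' k, if k = N then d N else 0)) := by
    refine tendsto_tsum_of_dominated_convergence
      (bound := fun k ↦ ‖Complex.Gamma (c + N)‖ * ‖d k / Complex.Gamma (c + k)‖)
      (hs.mul_left _) ?_ ?_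
    · intro k
      simp only [key]
      rcases lt_trichotomy k N with hk | hk | hk
      · simp [ih k hk, hk.ne]
      · simp [hk, poch_zero]
      · rw [if_neg hk.ne']
        simpa using (tendsto_inv_poch_add_nat (c + N) (Nat.sub_ne_zero_of_lt hk)).const_mul (d k)
    · refine Eventually.of_forall fun M k ↦ ?_
      have h0 := key 0 k
      simp only [Nat.cast_zero, add_zero] at h0
      rw [key, ← norm_mul, h0, norm_mul, norm_mul, norm_inv, norm_inv]
      have hp : 0 < (c + N).re := by simpa using hre 0 N
      have h1 : 0 < ‖poch (c + N) (k - N)‖ := norm_pos_iff.2 (poch_ne_zero hp _)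
      have h2 := norm_poch_le_norm_poch_add hp.le (t := M) M.cast_nonneg (k - N)
      rw [Complex.ofReal_natCast] at h2
      gcongr
  simp only [tsum_mul_left, h, mul_zero, tsum_ite_eq] at hlim
  exact (tendsto_nhds_unique tendsto_const_nhds hlim).symm

/-! ### Symmetries of the coefficients -/

/-- The Gamma quotient determines the coefficients: for `Re s` large, both inverse factorial series
converge to it absolutely. -/
theorem norlundCoeff_eq_of_norlundProd_eq {α α' β β' γ δ δ' ε ε' : ℂ} (hγ : 0 < γ.re)
    (h : ∀ s, norlundProd α α' β β' γ s = norlundProd δ δ' ε ε' γ s) (N : ℕ) :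
    norlundCoeff α α' β β' γ N = norlundCoeff δ δ' ε ε' γ N := by
  obtain ⟨K, hK⟩ : ∃ K : ℝ, ∀ z ∈ ({α, α', β, β', γ, δ, δ', ε, ε'} : Finset ℂ), ‖z‖ ≤ K :=
    (Set.Finite.isBounded (Finset.finite_toSet _)).exists_norm_le
  simp only [Finset.mem_insert, Finset.mem_singleton, forall_eq_or_imp, forall_eq] at hK
  obtain ⟨k1, k2, k3, k4, k5, k6, k7, k8, k9⟩ := hK
  have hb : ∀ {z : ℂ}, ‖z‖ ≤ K → z.re ≤ K ∧ -K ≤ z.re := fun {z} hz ↦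
    ⟨(Complex.re_le_norm z).trans hz, by
      have := (abs_le.1 ((Complex.abs_re_le_norm z).trans hz)).1
      exact this⟩
  have hK0 : 0 ≤ K := (norm_nonneg _).trans k1
  have b1 := hb k1
  have b2 := hb k2
  have b3 := hb k3
  have b4 := hb k4
  have b5 := hb k5
  have b6 := hb k6
  have b7 := hb k7
  have b8 := hb k8
  have b9 := hb k9
  -- For `Re s ≥ S`, both double series are majorized with `A = K + 1`.
  set S : ℝ := 4 * K + 2 with hS
  have key : ∀ (M : ℕ), ∀ {a a' b b' : ℂ}, a.re ≤ K ∧ -K ≤ a.re → a'.re ≤ K ∧ -K ≤ a'.re →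
      b.re ≤ K ∧ -K ≤ b.re → b'.re ≤ K ∧ -K ≤ b'.re →
      HasSum (fun N : ℕ ↦ norlundCoeff a a' b b' γ N / Complex.Gamma (γ + S + M + N))
        (norlundProd a a' b b' γ (S + M)) ∧
      Summable (fun N : ℕ ↦ ‖norlundCoeff a a' b b' γ N‖ / Real.Gamma ((γ + S).re + N)) := by
    intro M a a' b b' ha ha' hb hb'
    have hM : (0 : ℝ) ≤ M := M.cast_nonneg
    constructor
    · have := hasSum_norlundCoeff_div (α := a) (α' := a') (β := b) (β' := b') (γ := γ)
        (s := S + M) (A := K + 1) (by linarith) (by linarith)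
        (by simp; linarith) (by simp; linarith) (by simp; linarith)
      simpa only [add_assoc] using this
    · exact summable_norm_norlundCoeff_div (A := K + 1) (by linarith) (by linarith)
        (by simp; linarith) (by simp; linarith) (by simp; linarith)
  have hc : 0 < (γ + S).re := by simp; linarith
  obtain ⟨C, hC, hCb⟩ := exists_inv_norm_Gamma_le hc
  refine sub_eq_zero.1 (eq_zero_of_tsum_div_Gamma_eq_zero (c := γ + S)
    (d := fun N ↦ norlundCoeff α α' β β' γ N - norlundCoeff δ δ' ε ε' γ N) hc ?_ ?_ N)
  · refine Summable.of_nonneg_of_le (fun _ ↦ norm_nonneg _) (fun N ↦ ?_)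
      (((key 0 b1 b2 b3 b4).2.add (key 0 b6 b7 b8 b9).2).mul_left C)
    rw [norm_div, div_eq_mul_inv, ← add_div, mul_div_left_comm, div_eq_mul_inv, ← mul_assoc,
      mul_assoc]
    have := hCb N
    gcongr
    exact norm_sub_le _ _
  · intro M
    have := (key M b1 b2 b3 b4).1.sub (key M b6 b7 b8 b9).1
    rw [h, sub_self] at this
    simp only [← sub_div] at this
    exact this.tsum_eq

/-- The symmetry that puts `β` into the place of `α'`. -/
theorem norlundCoeff_symm_left {γ : ℂ} (hγ : 0 < γ.re) (α α' β β' : ℂ) (N : ℕ) :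
    norlundCoeff α α' β β' γ N = norlundCoeff (γ - β - β') β α' (γ - α - α') γ N := by
  refine norlundCoeff_eq_of_norlundProd_eq hγ (fun s ↦ ?_) N
  simp only [norlundProd]
  ring_nf

/-- The symmetry that puts `γ - β - β'` into the place of `α'`. -/
theorem norlundCoeff_symm_right {γ : ℂ} (hγ : 0 < γ.re) (α α' β β' : ℂ) (N : ℕ) :
    norlundCoeff α α' β β' γ N =
      norlundCoeff (α + α' + β + β' - γ) (γ - β - β') β (γ - β - α') γ N := by
  refine norlundCoeff_eq_of_norlundProd_eq hγ (fun s ↦ ?_) N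
  simp only [norlundProd]
  ring_nf

/-- Convergence under the sharp conditions on `s`: where `Re α' > 0` fails, the double series for
another parametrization of the same coefficients is the absolutely convergent one. -/
theorem hasSum_norlundCoeff_div_of_re_pos {α α' β β' γ s : ℂ} (hγ : 0 < γ.re) (hs : 0 < s.re)
    (h1 : 0 < (s + β' - α').re) (h2 : 0 < (s + γ - α - α' - β).re)
    (h : 0 < α'.re ∨ 0 < β.re ∨ 0 < (γ - β - β').re) :
    HasSum (fun N : ℕ ↦ norlundCoeff α α' β β' γ N / Complex.Gamma (γ + s + N))
        (norlundProd α α' β β' γ s) ∧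
      Summable (fun N : ℕ ↦ ‖norlundCoeff α α' β β' γ N‖ / Real.Gamma ((γ + s).re + N)) := by
  have key : ∀ {a a' b b' : ℂ}, 0 < a'.re → 0 < (s + b' - a').re → 0 < (s + γ - a - a' - b).re →
      HasSum (fun N : ℕ ↦ norlundCoeff a a' b b' γ N / Complex.Gamma (γ + s + N))
        (norlundProd a a' b b' γ s) ∧
      Summable (fun N : ℕ ↦ ‖norlundCoeff a a' b b' γ N‖ / Real.Gamma ((γ + s).re + N)) := by
    intro a a' b b' ha' h1 h2
    have h0 : 0 < (γ + s).re := by simp; linarith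
    have h1' : a'.re < (s + b').re := by simp at h1 ⊢; linarith
    have h2' : a'.re < (s + γ - a - b).re := by simp at h2 ⊢; linarith
    exact ⟨hasSum_norlundCoeff_div ha' le_rfl h0 h1' h2',
      summable_norm_norlundCoeff_div ha' le_rfl h0 h1' h2'⟩
  rcases h with h | h | h
  · exact key h h1 h2
  · simp only [norlundCoeff_symm_left hγ α α' β β']
    convert key (a := γ - β - β') (b := α') (b' := γ - α - α') h (by convert h2 using 2; ring)
      (by convert h1 using 2; ring) using 2
    simp only [norlundProd]
    ring_nf
  · simp only [norlundCoeff_symm_right hγ α α' β β']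
    convert key (a := α + α' + β + β' - γ) (b := β) (b' := γ - β - α') h
      (by convert h1 using 2; ring) (by convert h2 using 2; ring) using 2
    simp only [norlundProd]
    ring_nf

/-! ### Pfaff's transformation -/

theorem summable_mul_norm_gaussTerm_mul_pow (a b c : ℂ) {r : ℝ} (hr0 : 0 ≤ r) (hr : r < 1) :
    Summable fun n : ℕ ↦ ((n : ℝ) + 1) * ‖gaussTerm a b c n‖ * r ^ n := by
  obtain ⟨k, hk⟩ := exists_nat_gt ((a + b - c).re)
  refine summable_of_isBigO_nat
    (summable_pow_mul_geometric_of_norm_lt_one k (r := r) (by rwa [Real.norm_of_nonneg hr0]))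
    (IsBigO.mul ?_ (isBigO_refl _ _))
  have h1 : (fun n : ℕ ↦ (n : ℝ) + 1) =O[atTop] fun n : ℕ ↦ (n : ℝ) := by
    refine IsBigO.of_bound 2 ?_
    filter_upwards [eventually_ge_atTop 1] with n hn
    have : (1 : ℝ) ≤ n := by exact_mod_cast hn
    rw [Real.norm_of_nonneg (by positivity), Real.norm_of_nonneg (by positivity)]
    linarith
  refine (h1.mul (gaussTerm_isBigO a b c).norm_left).trans (IsBigO.of_bound 1 ?_)
  filter_upwards [eventually_ge_atTop 1] with n hn
  have hn1 : (1 : ℝ) ≤ n := by exact_mod_cast hn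
  rw [mul_comm, ← Real.rpow_add_one (by positivity), one_mul, ← Real.rpow_natCast,
    Real.norm_of_nonneg (by positivity), Real.norm_of_nonneg (by positivity)]
  gcongr
  linarith

theorem summable_norm_gaussTerm_mul_pow (a b c : ℂ) {r : ℝ} (hr0 : 0 ≤ r) (hr : r < 1) :
    Summable fun n : ℕ ↦ ‖gaussTerm a b c n‖ * r ^ n := by
  refine (summable_mul_norm_gaussTerm_mul_pow a b c hr0 hr).of_nonneg_of_le
    (fun n ↦ by positivity) fun n ↦ ?_
  have : (0 : ℝ) ≤ n := n.cast_nonneg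
  have : 0 ≤ ‖gaussTerm a b c n‖ * r ^ n := by positivity
  nlinarith

theorem norm_gaussTerm_eq {c : ℂ} (hc : 0 < c.re) (a b : ℂ) (n : ℕ) :
    ‖poch a n * poch b n / ((n ! : ℂ) * poch c n)‖ =
      ‖Complex.Gamma c‖ * ‖gaussTerm a b c n‖ := by
  have hΓ := Complex.Gamma_ne_zero_of_re_pos hc
  rw [gaussTerm, ← norm_mul, Gamma_add_nat hΓ]
  congr 1
  have := poch_ne_zero hc n
  have hf : (n ! : ℂ) ≠ 0 := by exact_mod_cast n.factorial_ne_zero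
  field_simp

/-- The terms of the binomial series of `(1 - r) ^ (-A)` are nonnegative. -/
theorem hasSum_norm_poch_div_factorial_mul_pow {A r : ℝ} (hA : 0 < A) (hr0 : 0 ≤ r) (hr : r < 1) :
    HasSum (fun k : ℕ ↦ ‖poch (A : ℂ) k / (k ! : ℂ)‖ * r ^ k) ((1 - r) ^ (-A)) := by
  have h := hasSum_poch_div_factorial_mul_pow (A : ℂ) (x := r) (by simpa [abs_of_nonneg hr0])
  rw [← Complex.hasSum_ofReal]
  have e : (((1 - r) ^ (-A) : ℝ) : ℂ) = (1 - (r : ℂ)) ^ (-(A : ℂ)) := by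
    rw [Complex.ofReal_cpow (by linarith)]
    push_cast
    rfl
  rw [e]
  refine h.congr_fun fun k ↦ ?_
  have hp : 0 < ∏ j ∈ range k, (A + j) := prod_pos fun j _ ↦ by positivity
  rw [poch_ofReal, norm_div, Complex.norm_real, Real.norm_of_nonneg hp.le]
  simp

/-- Absolute convergence of the double series obtained by expanding every power of `1 - w` in
`(1 - w)^(-a) ₂F₁(a, c - b; c; w / (w - 1))`. With a positive `A` in place of `a`, the inner sums
are binomial series; the outer one is a power series in `|w| / (1 - |w|)`. -/
theorem summable_pfaff (a b : ℂ) {c : ℂ} (hc : 0 < c.re) {w : ℂ} (hw : ‖w‖ < 1 / 2) :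
    Summable fun q : ℕ × ℕ ↦ poch a q.1 * poch (c - b) q.1 / ((q.1 ! : ℂ) * poch c q.1) *
      (-w) ^ q.1 * (poch (a + q.1) q.2 / (q.2 ! : ℂ) * w ^ q.2) := by
  set r := ‖w‖ with hr
  have hr0 : 0 ≤ r := norm_nonneg w
  obtain ⟨C, hC, hCb⟩ := exists_norm_poch_le a (A := max 1 a.re) (by positivity) (le_max_right _ _)
  set A : ℝ := max 1 a.re with hA
  have hA0 : 0 < A := by positivity
  have hrow : ∀ n : ℕ, HasSum (fun k : ℕ ↦
      C * ‖poch (A : ℂ) n * poch (c - b) n / ((n ! : ℂ) * poch c n)‖ * r ^ n *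
        (‖poch ((A + n : ℝ) : ℂ) k / (k ! : ℂ)‖ * r ^ k))
      (C * ‖poch (A : ℂ) n * poch (c - b) n / ((n ! : ℂ) * poch c n)‖ * r ^ n *
        (1 - r) ^ (-(A + n))) := fun n ↦
    (hasSum_norm_poch_div_factorial_mul_pow (by positivity) hr0 (by linarith)).mul_left _
  have hsum : Summable fun q : ℕ × ℕ ↦
      C * ‖poch (A : ℂ) q.1 * poch (c - b) q.1 / ((q.1 ! : ℂ) * poch c q.1)‖ * r ^ q.1 *
        (‖poch ((A + q.1 : ℝ) : ℂ) q.2 / (q.2 ! : ℂ)‖ * r ^ q.2) := by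
    rw [summable_prod_of_nonneg (fun q ↦ by positivity)]
    refine ⟨fun n ↦ (hrow n).summable, ?_⟩
    simp only [(hrow _).tsum_eq]
    have hr1 : r / (1 - r) < 1 := by
      rw [div_lt_one (by linarith)]
      linarith
    refine ((summable_norm_gaussTerm_mul_pow A (c - b) c (div_nonneg hr0 (by linarith))
      hr1).mul_left (C * ‖Complex.Gamma c‖ * (1 - r) ^ (-A))).congr fun n ↦ ?_
    have h1r : 0 < 1 - r := by linarith
    rw [norm_gaussTerm_eq hc, neg_add, Real.rpow_add h1r, Real.rpow_neg h1r.le (n : ℝ),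
      Real.rpow_natCast, div_pow]
    ring
  refine Summable.of_norm_bounded hsum fun q ↦ ?_
  obtain ⟨n, k⟩ := q
  have h1 := hCb (n + k)
  rw [poch_add, poch_add, norm_mul, norm_mul] at h1
  push_cast
  simp only [norm_mul, norm_div, norm_pow, norm_neg]
  have : ‖poch a n‖ * ‖poch (c - b) n‖ / (‖(n ! : ℂ)‖ * ‖poch c n‖) * r ^ n *
      (‖poch (a + n) k‖ / ‖(k ! : ℂ)‖ * r ^ k) = (‖poch a n‖ * ‖poch (a + n) k‖) *
      (‖poch (c - b) n‖ / (‖(n ! : ℂ)‖ * ‖poch c n‖) * r ^ n * (r ^ k / ‖(k ! : ℂ)‖)) := by ring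
  rw [this]
  refine (mul_le_mul_of_nonneg_right h1 (by positivity)).trans_eq ?_
  ring

/-- **Pfaff's transformation** of `₂F₁(a, b; c; w)` near `w = 0`. -/
theorem pfaff_transformation (a b : ℂ) {c : ℂ} (hc : 0 < c.re) {w : ℂ} (hw : ‖w‖ < 1 / 2) :
    (1 - w) ^ (-a) *
        ∑' n : ℕ, poch a n * poch (c - b) n / ((n ! : ℂ) * poch c n) * (w / (w - 1)) ^ n =
      ∑' n : ℕ, poch a n * poch b n / ((n ! : ℂ) * poch c n) * w ^ n := by
  have hs := summable_pfaff a b hc hw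
  have hw1 : 1 - w ≠ 0 := by
    intro h
    rw [sub_eq_zero] at h
    rw [← h] at hw
    norm_num at hw
  rw [← tsum_mul_left]
  trans ∑' q : ℕ × ℕ, poch a q.1 * poch (c - b) q.1 / ((q.1 ! : ℂ) * poch c q.1) *
      (-w) ^ q.1 * (poch (a + q.1) q.2 / (q.2 ! : ℂ) * w ^ q.2)
  · rw [hs.tsum_prod]
    refine tsum_congr fun n ↦ ?_
    dsimp only
    rw [tsum_mul_left, (hasSum_poch_div_factorial_mul_pow (a + n) (by linarith)).tsum_eq, neg_add,
      Complex.cpow_add _ _ hw1, Complex.cpow_neg _ (n : ℂ), Complex.cpow_natCast,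
      show w / (w - 1) = -w * (1 - w)⁻¹ by rw [← neg_sub 1 w, div_neg, neg_mul, div_eq_mul_inv],
      mul_pow, inv_pow]
    ring
  · rw [← hs.hasSum.sum_antidiagonal.tsum_eq]
    refine tsum_congr fun N ↦ ?_
    have hN := poch_div_factorial_eq_sum b c N
    have hpN := poch_ne_zero hc N
    have e : poch a N * poch b N / ((N ! : ℂ) * poch c N) * w ^ N =
        poch a N / poch c N * w ^ N * (poch b N / (N ! : ℂ)) := by
      field_simp
    rw [e, hN, mul_sum]
    refine sum_congr rfl fun q hq ↦ ?_
    obtain ⟨n, k⟩ := q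
    obtain rfl : n + k = N := mem_antidiagonal.1 hq
    have h1 := poch_ne_zero hc n
    have h2 : poch (c + n) k ≠ 0 := poch_ne_zero (by simp; positivity) k
    rw [poch_add, poch_add, neg_pow w, pow_add]
    field_simp

/-! ### The analytic continuation of Appell's function -/

/-- The double power series in `z` and `u = w / (w - 1)` which, multiplied by `(1 - w) ^ (-a')`,
is Appell's function `F₃(a, a', b, b'; c; z, w)`. -/
noncomputable def pfaffSeries (a a' b b' c : ℂ) (p : ℂ × ℂ) : ℂ :=
  ∑' q : ℕ × ℕ, norlundTerm a a' b b' c q / poch c (q.1 + q.2) * (p.1 ^ q.1 * p.2 ^ q.2)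

/-- `|(c - b' + m)_n / (c + m)_n|` grows at most polynomially in `n`, uniformly in `m`. -/
theorem norm_poch_sub_add_mul_le {c : ℂ} (hc : 0 < c.re) (b' : ℂ) (m n : ℕ) :
    ‖poch (c - b' + m) n‖ * ‖poch (c.re : ℂ) n‖ ≤
      ‖poch ((c.re + ‖c - b'‖ : ℝ) : ℂ) n‖ * ‖poch (c + m) n‖ := by
  simp only [poch_eq_prod, norm_prod, ← prod_mul_distrib]
  refine prod_le_prod (fun _ _ ↦ by positivity) fun j _ ↦ ?_
  set K := ‖c - b'‖ with hK
  have hK0 : 0 ≤ K := norm_nonneg _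
  have hj : (0 : ℝ) ≤ j := j.cast_nonneg
  have hm : (0 : ℝ) ≤ m := m.cast_nonneg
  have h1 : ‖c - b' + m + j‖ ≤ K + m + j := by
    refine norm_add₃_le.trans_eq ?_
    rw [Complex.norm_natCast, Complex.norm_natCast]
  have h2 : c.re + m + j ≤ ‖c + m + j‖ := by
    simpa using Complex.re_le_norm (c + m + j)
  have h3 : ‖(c.re : ℂ) + j‖ = c.re + j := by
    rw [← Complex.ofReal_natCast, ← Complex.ofReal_add, Complex.norm_real,
      Real.norm_of_nonneg (by positivity)]
  have h4 : ‖((c.re + K : ℝ) : ℂ) + j‖ = c.re + K + j := by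
    rw [← Complex.ofReal_natCast, ← Complex.ofReal_add, Complex.norm_real,
      Real.norm_of_nonneg (by positivity)]
  rw [h3, h4]
  calc ‖c - b' + m + j‖ * (c.re + j) ≤ (K + m + j) * (c.re + j) := by gcongr
    _ ≤ (c.re + K + j) * (c.re + m + j) := by nlinarith [mul_nonneg hK0 hm]
    _ ≤ _ := by gcongr

theorem inv_norm_poch_add_le {c : ℂ} (hc : 0 < c.re) (m n : ℕ) :
    ‖poch c (m + n)‖⁻¹ ≤ ‖poch (c.re : ℂ) m‖⁻¹ * ‖poch (c + m) n‖⁻¹ := by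
  have h1 : 0 < ‖poch (c.re : ℂ) m‖ := norm_pos_iff.2 (poch_ne_zero (by simpa using hc) m)
  have h2 := norm_poch_ofReal_re_le hc m
  rw [poch_add, norm_mul, mul_inv]
  gcongr

theorem norm_poch_ofReal_re_le_add {c : ℂ} (hc : 0 < c.re) (m n : ℕ) :
    ‖poch (c.re : ℂ) n‖ ≤ ‖poch (c + m) n‖ := by
  have hc' : 0 < (c + m).re := by simp; positivity
  refine le_trans ?_ (norm_poch_ofReal_re_le hc' n)
  have := norm_poch_le_norm_poch_add (c := (c.re : ℂ)) (by simpa using hc.le)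
    (t := m) m.cast_nonneg n
  simpa using this

theorem norm_norlundTerm_div_poch_le (a a' b b' : ℂ) {c : ℂ} (hc : 0 < c.re) (m n : ℕ) :
    ‖norlundTerm a a' b b' c (m, n) / poch c (m + n)‖ ≤
      (‖Complex.Gamma c.re‖ * ‖gaussTerm a b c.re m‖) *
        (‖Complex.Gamma c.re‖ * ‖gaussTerm a' ((c.re + ‖c - b'‖ : ℝ) : ℂ) c.re n‖) := by
  have hc' : 0 < (c.re : ℂ).re := by simpa using hc
  rw [← norm_gaussTerm_eq hc', ← norm_gaussTerm_eq hc', norlundTerm]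
  have h1 := inv_norm_poch_add_le hc m n
  have h2 := norm_poch_sub_add_mul_le hc b' m n
  have hp : 0 < ‖poch (c.re : ℂ) n‖ := norm_pos_iff.2 (poch_ne_zero hc' n)
  have hp' : 0 < ‖poch (c + m) n‖ := norm_pos_iff.2 (poch_ne_zero (by simp; positivity) n)
  have h3 : ‖poch (c - b' + m) n‖ * ‖poch (c + m) n‖⁻¹ ≤
      ‖poch ((c.re + ‖c - b'‖ : ℝ) : ℂ) n‖ * ‖poch (c.re : ℂ) n‖⁻¹ := by
    rw [← div_eq_mul_inv, ← div_eq_mul_inv, div_le_div_iff₀ hp' hp]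
    exact h2
  simp only [norm_mul, norm_div]
  calc _ = ‖poch a m‖ * ‖poch b m‖ / ‖(m ! : ℂ)‖ *
        (‖poch a' n‖ / ‖(n ! : ℂ)‖ * (‖poch (c - b' + m) n‖ * ‖poch c (m + n)‖⁻¹)) := by
        rw [div_eq_mul_inv _ ‖poch c (m + n)‖]; ring
    _ ≤ ‖poch a m‖ * ‖poch b m‖ / ‖(m ! : ℂ)‖ * (‖poch a' n‖ / ‖(n ! : ℂ)‖ *
        (‖poch (c - b' + m) n‖ * (‖poch (c.re : ℂ) m‖⁻¹ * ‖poch (c + m) n‖⁻¹))) := by gcongr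
    _ = ‖poch a m‖ * ‖poch b m‖ / ‖(m ! : ℂ)‖ * (‖poch a' n‖ / ‖(n ! : ℂ)‖ *
        ‖poch (c.re : ℂ) m‖⁻¹ * (‖poch (c - b' + m) n‖ * ‖poch (c + m) n‖⁻¹)) := by ring
    _ ≤ ‖poch a m‖ * ‖poch b m‖ / ‖(m ! : ℂ)‖ * (‖poch a' n‖ / ‖(n ! : ℂ)‖ *
        ‖poch (c.re : ℂ) m‖⁻¹ * (‖poch ((c.re + ‖c - b'‖ : ℝ) : ℂ) n‖ *
          ‖poch (c.re : ℂ) n‖⁻¹)) := by gcongr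
    _ = _ := by ring

/-- The majorant contains the factors `m + 1`, `n + 1` that differentiation produces. -/
theorem summable_norlundTerm_majorant (a a' b b' : ℂ) {c : ℂ} (hc : 0 < c.re) {r : ℝ}
    (hr0 : 0 ≤ r) (hr : r < 1) :
    Summable fun q : ℕ × ℕ ↦ ((q.1 : ℝ) + 1) * ((q.2 : ℝ) + 1) *
      ‖norlundTerm a a' b b' c q / poch c (q.1 + q.2)‖ * (r ^ q.1 * r ^ q.2) := by
  have h := ((summable_mul_norm_gaussTerm_mul_pow a b c.re hr0 hr).mul_left
      ‖Complex.Gamma c.re‖).mul_of_nonneg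
    ((summable_mul_norm_gaussTerm_mul_pow a' ((c.re + ‖c - b'‖ : ℝ) : ℂ) c.re hr0 hr).mul_left
      ‖Complex.Gamma c.re‖) (fun _ ↦ by positivity) (fun _ ↦ by positivity)
  refine h.of_nonneg_of_le (fun q ↦ by positivity) fun q ↦ ?_
  have := norm_norlundTerm_div_poch_le a a' b b' hc q.1 q.2
  calc _ ≤ ((q.1 : ℝ) + 1) * ((q.2 : ℝ) + 1) *
      ((‖Complex.Gamma c.re‖ * ‖gaussTerm a b c.re q.1‖) *
        (‖Complex.Gamma c.re‖ * ‖gaussTerm a' ((c.re + ‖c - b'‖ : ℝ) : ℂ) c.re q.2‖)) *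
        (r ^ q.1 * r ^ q.2) := by gcongr
    _ = _ := by ring

theorem summable_pfaffSeries (a a' b b' : ℂ) {c : ℂ} (hc : 0 < c.re) {p : ℂ × ℂ} (hp : ‖p‖ < 1) :
    Summable fun q : ℕ × ℕ ↦
      norlundTerm a a' b b' c q / poch c (q.1 + q.2) * (p.1 ^ q.1 * p.2 ^ q.2) := by
  refine Summable.of_norm_bounded
    (summable_norlundTerm_majorant a a' b b' hc (norm_nonneg p) hp) fun q ↦ ?_
  rw [norm_mul, norm_mul, norm_pow, norm_pow]
  have h1 := norm_fst_le p
  have h2 := norm_snd_le p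
  have h3 : (1 : ℝ) ≤ ((q.1 : ℝ) + 1) * ((q.2 : ℝ) + 1) :=
    one_le_mul_of_one_le_of_one_le (by simp) (by simp)
  calc _ ≤ ‖norlundTerm a a' b b' c q / poch c (q.1 + q.2)‖ * (‖p‖ ^ q.1 * ‖p‖ ^ q.2) := by gcongr
    _ = 1 * (‖norlundTerm a a' b b' c q / poch c (q.1 + q.2)‖ * (‖p‖ ^ q.1 * ‖p‖ ^ q.2)) := by ring
    _ ≤ ((q.1 : ℝ) + 1) * ((q.2 : ℝ) + 1) *
        (‖norlundTerm a a' b b' c q / poch c (q.1 + q.2)‖ * (‖p‖ ^ q.1 * ‖p‖ ^ q.2)) := by gcongr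
    _ = _ := by ring

theorem norm_natCast_mul_pow_pred_le {z : ℂ} {r : ℝ} (hr : 0 < r) (hz : ‖z‖ ≤ r) (m : ℕ) :
    ‖(m : ℂ) * z ^ (m - 1)‖ ≤ r⁻¹ * (m * r ^ m) := by
  rcases m with _ | m
  · simp
  · rw [norm_mul, norm_pow, Complex.norm_natCast, Nat.add_sub_cancel, pow_succ]
    have : r⁻¹ * (((m + 1 : ℕ) : ℝ) * (r ^ m * r)) = ((m + 1 : ℕ) : ℝ) * r ^ m := by
      field_simp
    rw [this]
    gcongr

theorem differentiableAt_pfaffSeries (a a' b b' : ℂ) {c : ℂ} (hc : 0 < c.re) {p : ℂ × ℂ}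
    (hp : ‖p‖ < 1) : DifferentiableAt ℂ (pfaffSeries a a' b b' c) p := by
  obtain ⟨r, hpr, hr⟩ := exists_between hp
  have hr0 : 0 < r := (norm_nonneg p).trans_lt hpr
  have hsum := (summable_norlundTerm_majorant a a' b b' hc hr0.le hr).mul_left r⁻¹
  let D : ℕ × ℕ → ℂ × ℂ → (ℂ × ℂ →L[ℂ] ℂ) := fun q x ↦
    (norlundTerm a a' b b' c q / poch c (q.1 + q.2)) •
      (x.1 ^ q.1 • (((q.2 : ℂ) * x.2 ^ (q.2 - 1)) • ContinuousLinearMap.snd ℂ ℂ ℂ) +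
        x.2 ^ q.2 • (((q.1 : ℂ) * x.1 ^ (q.1 - 1)) • ContinuousLinearMap.fst ℂ ℂ ℂ))
  refine (hasFDerivAt_tsum_of_isPreconnected (f := fun (q : ℕ × ℕ) (x : ℂ × ℂ) ↦
    norlundTerm a a' b b' c q / poch c (q.1 + q.2) * (x.1 ^ q.1 * x.2 ^ q.2)) (f' := D)
    hsum Metric.isOpen_ball (convex_ball (0 : ℂ × ℂ) r).isPreconnected ?_ ?_
    (Metric.mem_ball_self hr0) (summable_pfaffSeries a a' b b' hc (by simp))
    (by simpa using hpr)).differentiableAt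
  · intro q x _
    have h1 : HasFDerivAt (fun x : ℂ × ℂ ↦ x.1 ^ q.1)
        (((q.1 : ℂ) * x.1 ^ (q.1 - 1)) • ContinuousLinearMap.fst ℂ ℂ ℂ) x :=
      (hasDerivAt_pow q.1 x.1).comp_hasFDerivAt x hasFDerivAt_fst
    have h2 : HasFDerivAt (fun x : ℂ × ℂ ↦ x.2 ^ q.2)
        (((q.2 : ℂ) * x.2 ^ (q.2 - 1)) • ContinuousLinearMap.snd ℂ ℂ ℂ) x :=
      (hasDerivAt_pow q.2 x.2).comp_hasFDerivAt x hasFDerivAt_snd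
    exact (h1.mul h2).const_mul _
  · intro q x hx
    have hx' : ‖x‖ ≤ r := (mem_ball_zero_iff.1 hx).le
    have hx1 := (norm_fst_le x).trans hx'
    have hx2 := (norm_snd_le x).trans hx'
    have e1 := norm_natCast_mul_pow_pred_le hr0 hx1 q.1
    have e2 := norm_natCast_mul_pow_pred_le hr0 hx2 q.2
    have f1 : ‖ContinuousLinearMap.fst ℂ ℂ ℂ‖ ≤ 1 := ContinuousLinearMap.norm_fst_le ..
    have f2 : ‖ContinuousLinearMap.snd ℂ ℂ ℂ‖ ≤ 1 := ContinuousLinearMap.norm_snd_le ..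
    simp only [D]
    rw [norm_smul]
    have hn : ‖x.1 ^ q.1 • (((q.2 : ℂ) * x.2 ^ (q.2 - 1)) • ContinuousLinearMap.snd ℂ ℂ ℂ) +
        x.2 ^ q.2 • (((q.1 : ℂ) * x.1 ^ (q.1 - 1)) • ContinuousLinearMap.fst ℂ ℂ ℂ)‖ ≤
        r ^ q.1 * (r⁻¹ * (q.2 * r ^ q.2) * 1) + r ^ q.2 * (r⁻¹ * (q.1 * r ^ q.1) * 1) := by
      refine (norm_add_le _ _).trans ?_
      simp only [norm_smul, norm_pow]
      gcongr
    calc _ ≤ ‖norlundTerm a a' b b' c q / poch c (q.1 + q.2)‖ *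
        (r ^ q.1 * (r⁻¹ * (q.2 * r ^ q.2) * 1) + r ^ q.2 * (r⁻¹ * (q.1 * r ^ q.1) * 1)) := by gcongr
      _ = r⁻¹ * (((q.1 : ℝ) + q.2) * ‖norlundTerm a a' b b' c q / poch c (q.1 + q.2)‖ *
          (r ^ q.1 * r ^ q.2)) := by ring
      _ ≤ _ := by
        gcongr
        have h1 : (0 : ℝ) ≤ q.1 := Nat.cast_nonneg _
        have h2 : (0 : ℝ) ≤ q.2 := Nat.cast_nonneg _
        nlinarith

theorem summable_appellF3Series (a a' b b' : ℂ) {c z w : ℂ} (hc : 0 < c.re) (hz : ‖z‖ < 1)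
    (hw : ‖w‖ < 1) :
    Summable fun q : ℕ × ℕ ↦ poch a q.1 * poch a' q.2 * poch b q.1 * poch b' q.2 /
      (poch c (q.1 + q.2) * (q.1 ! : ℂ) * (q.2 ! : ℂ)) * z ^ q.1 * w ^ q.2 := by
  have hc' : 0 < (c.re : ℂ).re := by simpa using hc
  have h := ((summable_norm_gaussTerm_mul_pow a b c.re (norm_nonneg z) hz).mul_left
      ‖Complex.Gamma c.re‖).mul_of_nonneg
    ((summable_norm_gaussTerm_mul_pow a' b' c.re (norm_nonneg w) hw).mul_left
      ‖Complex.Gamma c.re‖) (fun _ ↦ by positivity) (fun _ ↦ by positivity)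
  refine Summable.of_norm_bounded h fun q ↦ ?_
  simp only [← mul_assoc ‖Complex.Gamma c.re‖, ← norm_gaussTerm_eq hc']
  obtain ⟨m, n⟩ := q
  have h1 := inv_norm_poch_add_le hc m n
  have h2 := norm_poch_ofReal_re_le_add hc m n
  have hp : 0 < ‖poch (c.re : ℂ) n‖ := norm_pos_iff.2 (poch_ne_zero hc' n)
  have h3 : ‖poch c (m + n)‖⁻¹ ≤ ‖poch (c.re : ℂ) m‖⁻¹ * ‖poch (c.re : ℂ) n‖⁻¹ := by
    refine h1.trans ?_
    gcongr
  simp only [norm_mul, norm_div, norm_pow]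
  calc _ = ‖poch a m‖ * ‖poch b m‖ * ‖poch a' n‖ * ‖poch b' n‖ / (‖(m ! : ℂ)‖ * ‖(n ! : ℂ)‖) *
        ‖poch c (m + n)‖⁻¹ * (‖z‖ ^ m * ‖w‖ ^ n) := by simp only [div_eq_mul_inv, mul_inv]; ring
    _ ≤ ‖poch a m‖ * ‖poch b m‖ * ‖poch a' n‖ * ‖poch b' n‖ / (‖(m ! : ℂ)‖ * ‖(n ! : ℂ)‖) *
        (‖poch (c.re : ℂ) m‖⁻¹ * ‖poch (c.re : ℂ) n‖⁻¹) * (‖z‖ ^ m * ‖w‖ ^ n) := by gcongr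
    _ = _ := by simp only [div_eq_mul_inv, mul_inv]; ring

theorem norm_div_sub_one_lt_one {w : ℂ} (hw : w.re < 1 / 2) : ‖w / (w - 1)‖ < 1 := by
  have hw1 : w - 1 ≠ 0 := by
    intro h
    have := congrArg Complex.re h
    simp at this
    linarith
  rw [norm_div, div_lt_one (norm_pos_iff.2 hw1), ← sq_lt_sq₀ (norm_nonneg _) (norm_nonneg _),
    Complex.sq_norm, Complex.sq_norm, Complex.normSq_apply, Complex.normSq_apply]
  simp
  nlinarith

/-- Pfaff's transformation in the second variable, applied to the double series of `F₃`. -/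
theorem appellF3Series_eq_pfaffSeries (a a' b b' : ℂ) {c z w : ℂ} (hc : 0 < c.re) (hz : ‖z‖ < 1)
    (hw : ‖w‖ < 1 / 2) :
    (1 - w) ^ (-a') * pfaffSeries a a' b b' c (z, w / (w - 1)) =
      appellF3Series a a' b b' c z w := by
  have hu : ‖w / (w - 1)‖ < 1 := norm_div_sub_one_lt_one
    ((Complex.re_le_norm w).trans_lt hw)
  have hp : ‖(z, w / (w - 1))‖ < 1 := by
    rw [Prod.norm_def]
    exact max_lt hz hu
  rw [pfaffSeries, appellF3Series, (summable_pfaffSeries a a' b b' hc hp).tsum_prod,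
    (summable_appellF3Series a a' b b' hc hz (by linarith)).tsum_prod, ← tsum_mul_left]
  refine tsum_congr fun m ↦ ?_
  have hcm : 0 < (c + m).re := by simp; positivity
  have h := pfaff_transformation a' b' hcm hw
  have hm := poch_ne_zero hc m
  trans poch a m * poch b m / ((m ! : ℂ) * poch c m) * z ^ m * ((1 - w) ^ (-a') *
    ∑' n : ℕ, poch a' n * poch (c + m - b') n / ((n ! : ℂ) * poch (c + m) n) * (w / (w - 1)) ^ n)
  · rw [← tsum_mul_left, ← tsum_mul_left, ← tsum_mul_left]
    refine tsum_congr fun n ↦ ?_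
    simp only [norlundTerm]
    rw [poch_add, show c - b' + m = c + m - b' by ring]
    simp only [div_eq_mul_inv, mul_inv]
    ring
  · rw [h, ← tsum_mul_left]
    refine tsum_congr fun n ↦ ?_
    dsimp only
    rw [poch_add]
    simp only [div_eq_mul_inv, mul_inv]
    ring

/-- Existence of the continuation: `|w / (w - 1)| < 1` exactly when `Re w < 1/2`. -/
theorem isAppellF3_pfaffSeries (a a' b b' : ℂ) {c : ℂ} (hc : 0 < c.re) :
    IsAppellF3 a a' b b' c
      fun q ↦ (1 - q.2) ^ (-a') * pfaffSeries a a' b b' c (q.1, q.2 / (q.2 - 1)) := by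
  constructor
  · rintro ⟨z, w⟩ ⟨hz, hw⟩
    simp only at hz hw
    have hw1 : w - 1 ≠ 0 := by
      intro h
      have := congrArg Complex.re h
      simp at this
      linarith
    have hp : ‖(z, w / (w - 1))‖ < 1 := by
      rw [Prod.norm_def]
      exact max_lt hz (norm_div_sub_one_lt_one hw)
    refine DifferentiableAt.differentiableWithinAt (DifferentiableAt.mul ?_ ?_)
    · refine DifferentiableAt.cpow_const ?_ (Or.inl ?_)
      · fun_prop
      · simp
        linarith
    · refine DifferentiableAt.comp (z, w) (g := pfaffSeries a a' b b' c)
        (f := fun q : ℂ × ℂ ↦ (q.1, q.2 / (q.2 - 1)))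
        (differentiableAt_pfaffSeries a a' b b' hc hp) ?_
      have h2 : DifferentiableAt ℂ (fun q : ℂ × ℂ ↦ q.2 - 1) (z, w) := by fun_prop
      simp only [div_eq_mul_inv]
      exact differentiableAt_fst.prodMk (differentiableAt_snd.fun_mul (h2.fun_inv hw1))
  · filter_upwards [Metric.ball_mem_nhds (0 : ℂ × ℂ) (by norm_num : (0 : ℝ) < 1 / 2)] with q hq
    have hq' : ‖q‖ < 1 / 2 := by simpa using hq
    exact appellF3Series_eq_pfaffSeries a a' b b' hc
      ((norm_fst_le q).trans_lt (by linarith)) ((norm_snd_le q).trans_lt hq')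

/-- Uniqueness of the continuation, by restriction to the complex lines through the origin: the
region is convex, so that its section by such a line is connected. -/
theorem IsAppellF3.eqOn {a a' b b' c : ℂ} {F G : ℂ × ℂ → ℂ} (hF : IsAppellF3 a a' b b' c F)
    (hG : IsAppellF3 a a' b b' c G) : Set.EqOn F G appellF3Region := by
  intro q hq
  have hR : appellF3Region =
      (LinearMap.fst ℝ ℂ ℂ) ⁻¹' Metric.ball 0 1 ∩ {p : ℂ × ℂ | p.2.re < 1 / 2} := by
    ext
    simp [appellF3Region]
  have hopen : IsOpen appellF3Region := by
    rw [hR]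
    exact (Metric.isOpen_ball.preimage continuous_fst).inter
      (isOpen_lt (Complex.continuous_re.comp continuous_snd) continuous_const)
  have hconv : Convex ℝ appellF3Region := by
    rw [hR]
    refine Convex.inter ?_ ?_
    · exact (convex_ball _ _).linear_preimage _
    · exact convex_halfSpace_lt (Complex.reLm.comp (LinearMap.snd ℝ ℂ ℂ)).isLinear _
  let L : ℂ →L[ℂ] ℂ × ℂ := ContinuousLinearMap.toSpanSingleton ℂ q
  let U : Set ℂ := L ⁻¹' appellF3Region
  have hU : IsOpen U := hopen.preimage L.continuous
  have hUc : IsPreconnected U :=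
    (hconv.linear_preimage (L.toLinearMap.restrictScalars ℝ)).isPreconnected
  have hd : ∀ {H : ℂ × ℂ → ℂ}, DifferentiableOn ℂ H appellF3Region →
      AnalyticOnNhd ℂ (fun t ↦ H (L t)) U := fun {H} hH ↦
    (hH.comp L.differentiable.differentiableOn (Set.mapsTo_preimage _ _)).analyticOnNhd hU
  have h0 : (0 : ℂ) ∈ U := by
    simp [U, appellF3Region]
  have h1 : (1 : ℂ) ∈ U := by
    simpa [U, L] using hq
  have hev : (fun t ↦ F (L t)) =ᶠ[𝓝 0] fun t ↦ G (L t) := by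
    have hL : Tendsto L (𝓝 0) (𝓝 0) := by
      simpa using L.continuous.tendsto 0
    filter_upwards [hL.eventually hF.2, hL.eventually hG.2] with t ht ht'
    rw [ht, ht']
  have := (hd hF.1).eqOn_of_preconnected_of_eventuallyEq (hd hG.1) hUc h0 hev h1
  simpa [L] using this

theorem appellF3_eq_pfaffSeries (a a' b b' : ℂ) {c z w : ℂ} (hc : 0 < c.re) (hz : ‖z‖ < 1)
    (hw : w.re < 1 / 2) :
    appellF3 a a' b b' c z w = (1 - w) ^ (-a') * pfaffSeries a a' b b' c (z, w / (w - 1)) :=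
  (Classical.epsilon_spec ⟨_, isAppellF3_pfaffSeries a a' b b' hc⟩ :
    IsAppellF3 a a' b b' c (Classical.epsilon (IsAppellF3 a a' b b' c))).eqOn
    (isAppellF3_pfaffSeries a a' b b' hc) (x := (z, w)) ⟨hz, hw⟩

/-- The double series, hence its continuation, is symmetric under `a' ↔ b'`. -/
theorem appellF3_swap (a a' b b' c z w : ℂ) :
    appellF3 a a' b b' c z w = appellF3 a b' b a' c z w := by
  have h : IsAppellF3 a a' b b' c = IsAppellF3 a b' b a' c := by
    funext F
    simp only [IsAppellF3, appellF3Series]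
    have : ∀ z w : ℂ, ∀ q : ℕ × ℕ, poch a q.1 * poch a' q.2 * poch b q.1 * poch b' q.2 /
        (poch c (q.1 + q.2) * (q.1 ! : ℂ) * (q.2 ! : ℂ)) * z ^ q.1 * w ^ q.2 =
        poch a q.1 * poch b' q.2 * poch b q.1 * poch a' q.2 /
        (poch c (q.1 + q.2) * (q.1 ! : ℂ) * (q.2 ! : ℂ)) * z ^ q.1 * w ^ q.2 := by
      intro z w q
      ring
    simp only [this]
  rw [appellF3, appellF3, h]

/-! ### The Mellin transform of the kernel -/

/-- The sum of a series that converges absolutely in `L¹` is integrable. -/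
theorem integrable_of_hasSum {X : Type*} [MeasurableSpace X] {μ : Measure X} {F : ℕ → X → ℂ}
    {f : X → ℂ} (hF : ∀ i, Integrable (F i) μ) (hs : Summable fun i ↦ ∫ a, ‖F i a‖ ∂μ)
    (hf : ∀ᵐ a ∂μ, HasSum (fun i ↦ F i a) (f a)) : Integrable f μ := by
  refine ⟨aestronglyMeasurable_of_tendsto_ae atTop
    (f := fun n a ↦ ∑ i ∈ range n, F i a)
    (fun n ↦ (integrable_finsetSum _ fun i _ ↦ hF i).aestronglyMeasurable)
    (hf.mono fun a ha ↦ ha.tendsto_sum_nat), ?_⟩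
  calc ∫⁻ a, ‖f a‖ₑ ∂μ ≤ ∫⁻ a, ∑' i, ‖F i a‖ₑ ∂μ := by
        refine lintegral_mono_ae (hf.mono fun a ha ↦ ?_)
        rw [← ha.tsum_eq]
        exact enorm_tsum_le_tsum_enorm
    _ = ∑' i, ∫⁻ a, ‖F i a‖ₑ ∂μ :=
        lintegral_tsum fun i ↦ (hF i).aestronglyMeasurable.enorm
    _ = ∑' i, ENNReal.ofReal (∫ a, ‖F i a‖ ∂μ) := by
        simp only [ofReal_integral_norm_eq_lintegral_enorm (hF _)]
    _ < ⊤ := hs.tsum_ofReal_lt_top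

theorem integrableOn_beta {u v : ℂ} (hu : 0 < u.re) (hv : 0 < v.re) {x : ℝ} (hx : 0 < x) :
    IntegrableOn (fun t : ℝ ↦ (t : ℂ) ^ (u - 1) * ((x - t : ℝ) : ℂ) ^ (v - 1)) (Set.Ioo 0 x) := by
  have h := (Complex.betaIntegral_convergent hu hv).comp_mul_right (c := x⁻¹)
  simp only [zero_mul, div_inv_eq_mul, one_mul] at h
  rw [intervalIntegrable_iff_integrableOn_Ioo_of_le hx.le] at h
  refine IntegrableOn.congr_fun (h.const_mul ((x : ℂ) ^ (u - 1) * (x : ℂ) ^ (v - 1)))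
    (fun t ht ↦ ?_) measurableSet_Ioo
  have hxc : (x : ℂ) ≠ 0 := by exact_mod_cast hx.ne'
  have h1 : 0 ≤ t * x⁻¹ := mul_nonneg ht.1.le (inv_nonneg.2 hx.le)
  have h2 : 0 ≤ 1 - t * x⁻¹ := by
    rw [sub_nonneg, ← div_eq_mul_inv, div_le_one hx]
    exact ht.2.le
  have e1 : (t : ℂ) = (x : ℂ) * ((t * x⁻¹ : ℝ) : ℂ) := by
    push_cast
    field_simp
  have e2 : ((x - t : ℝ) : ℂ) = (x : ℂ) * ((1 - t * x⁻¹ : ℝ) : ℂ) := by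
    push_cast
    field_simp
  have e3 : (t : ℂ) ^ (u - 1) = (x : ℂ) ^ (u - 1) * ((t * x⁻¹ : ℝ) : ℂ) ^ (u - 1) := by
    rw [← Complex.mul_cpow_ofReal_nonneg hx.le h1, ← e1]
  have e4 : (1 : ℂ) - ((t * x⁻¹ : ℝ) : ℂ) = ((1 - t * x⁻¹ : ℝ) : ℂ) := by push_cast; rfl
  rw [e2, Complex.mul_cpow_ofReal_nonneg hx.le h2, e3, e4]
  ring

theorem setIntegral_beta {u v : ℂ} (hu : 0 < u.re) (hv : 0 < v.re) {x : ℝ} (hx : 0 < x) :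
    ∫ t in Set.Ioo 0 x, (t : ℂ) ^ (u - 1) * ((x - t : ℝ) : ℂ) ^ (v - 1) =
      (x : ℂ) ^ (u + v - 1) * (Complex.Gamma u * Complex.Gamma v / Complex.Gamma (u + v)) := by
  have hΓ : Complex.Gamma (u + v) ≠ 0 := Complex.Gamma_ne_zero_of_re_pos (by simp; linarith)
  rw [Complex.Gamma_mul_Gamma_eq_betaIntegral hu hv, mul_div_cancel_left₀ _ hΓ,
    ← Complex.betaIntegral_scaled u v hx, intervalIntegral.integral_of_le hx.le,
    integral_Ioc_eq_integral_Ioo]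
  simp only [Complex.ofReal_sub]

theorem setIntegral_norm_beta {u v : ℂ} (hu : 0 < u.re) (hv : 0 < v.re) {x : ℝ} (hx : 0 < x) :
    ∫ t in Set.Ioo 0 x, ‖(t : ℂ) ^ (u - 1) * ((x - t : ℝ) : ℂ) ^ (v - 1)‖ =
      x ^ (u.re + v.re - 1) *
        (Real.Gamma u.re * Real.Gamma v.re / Real.Gamma (u.re + v.re)) := by
  have h := setIntegral_beta (u := u.re) (v := v.re) (by simpa) (by simpa) hx
  rw [← Complex.ofReal_inj]
  rw [← integral_complex_ofReal]
  refine (setIntegral_congr_fun measurableSet_Ioo fun t ht ↦ ?_).trans (h.trans ?_)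
  · have h1 : 0 < x - t := sub_pos.2 ht.2
    simp only [norm_mul]
    rw [Complex.norm_cpow_eq_rpow_re_of_pos ht.1, Complex.norm_cpow_eq_rpow_re_of_pos h1]
    push_cast
    rw [Complex.ofReal_cpow ht.1.le, Complex.ofReal_cpow h1.le]
    simp
  · push_cast [← Complex.Gamma_ofReal]
    rw [Complex.ofReal_cpow hx.le]
    push_cast
    rfl

/-- On the curve that carries the kernel, `z = 1 - t/x` and `w = 1 - x/t` satisfy `w / (w - 1) = z`,
and the double series collapses to a power series. -/
theorem hasSum_kernel {γ : ℂ} (hγ : 0 < γ.re) (α α' β β' : ℂ) {x t : ℝ} (ht : t ∈ Set.Ioo 0 x) :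
    HasSum (fun N : ℕ ↦ (x : ℂ) ^ (-α') * (norlundCoeff α α' β β' γ N / poch γ N *
      (1 - (t : ℂ) / x) ^ N))
      ((t : ℂ) ^ (-α') * appellF3 α α' β β' γ (1 - (t : ℂ) / x) (1 - (x : ℂ) / t)) := by
  obtain ⟨ht0, htx⟩ := ht
  have hx0 : 0 < x := ht0.trans htx
  have htc : (t : ℂ) ≠ 0 := by exact_mod_cast ht0.ne'
  have hxc : (x : ℂ) ≠ 0 := by exact_mod_cast hx0.ne'
  have hz : ‖1 - (t : ℂ) / x‖ < 1 := by
    have : 1 - (t : ℂ) / x = ((1 - t / x : ℝ) : ℂ) := by push_cast; rfl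
    have h1 : t / x < 1 := (div_lt_one hx0).2 htx
    have h2 : 0 < t / x := div_pos ht0 hx0
    rw [this, Complex.norm_real, Real.norm_of_nonneg (by linarith)]
    linarith
  have hw : (1 - (x : ℂ) / t).re < 1 / 2 := by
    have : 1 - (x : ℂ) / t = ((1 - x / t : ℝ) : ℂ) := by push_cast; rfl
    have h1 : 1 < x / t := (one_lt_div ht0).2 htx
    rw [this, Complex.ofReal_re]
    linarith
  have hu : (1 - (x : ℂ) / t) / (1 - (x : ℂ) / t - 1) = 1 - (t : ℂ) / x := by
    have : 1 - (x : ℂ) / t - 1 ≠ 0 := by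
      simp [htc, hxc]
    rw [div_eq_iff this]
    field_simp
    ring
  rw [appellF3_eq_pfaffSeries _ _ _ _ hγ hz hw, hu, ← mul_assoc]
  have hpow : (t : ℂ) ^ (-α') * (1 - (1 - (x : ℂ) / t)) ^ (-α') = (x : ℂ) ^ (-α') := by
    have : 1 - (1 - (x : ℂ) / t) = ((x / t : ℝ) : ℂ) := by push_cast; ring
    rw [this, ← Complex.mul_cpow_ofReal_nonneg ht0.le (by positivity)]
    congr 1
    push_cast
    field_simp
  rw [hpow]
  refine HasSum.mul_left _ ?_
  have h := (summable_pfaffSeries α α' β β' hγ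
    (p := (1 - (t : ℂ) / x, 1 - (t : ℂ) / x)) (by simpa [Prod.norm_def] using hz)).hasSum
  refine h.sum_antidiagonal.congr_fun fun N ↦ ?_
  rw [norlundCoeff, sum_div, sum_mul]
  refine sum_congr rfl fun q hq ↦ ?_
  rw [mem_antidiagonal.1 hq, ← pow_add, mem_antidiagonal.1 hq]

/-- The kernel `(x - t) ^ (γ - 1) t ^ (-α') F₃(α, α', β, β'; γ; 1 - t/x, 1 - x/t)`. -/
noncomputable def msmKernel (α α' β β' γ : ℂ) (x t : ℝ) : ℂ :=
  ((x - t : ℝ) : ℂ) ^ (γ - 1) * (t : ℂ) ^ (-α') *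
    appellF3 α α' β β' γ (1 - (t : ℂ) / (x : ℂ)) (1 - (x : ℂ) / (t : ℂ))

/-- The Mellin transform of the kernel, by termwise integration, in the cases in which a
parametrization of the coefficients with an absolutely convergent double series exists. -/
theorem msmKernel_mellin_of_re_pos {α α' β β' γ s : ℂ} (hγ : 0 < γ.re) (hs : 0 < s.re)
    (h1 : 0 < (s + β' - α').re) (h2 : 0 < (s + γ - α - α' - β).re)
    (h : 0 < α'.re ∨ 0 < β.re ∨ 0 < (γ - β - β').re) {x : ℝ} (hx : 0 < x) :
    IntegrableOn (fun t ↦ msmKernel α α' β β' γ x t * (t : ℂ) ^ (s - 1)) (Set.Ioo 0 x) ∧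
    ∫ t in Set.Ioo 0 x, msmKernel α α' β β' γ x t * (t : ℂ) ^ (s - 1) =
      (x : ℂ) ^ (s + γ - α' - 1) *
        (Complex.Gamma γ * (Complex.Gamma s * norlundProd α α' β β' γ s)) := by
  obtain ⟨hsum, hsumm⟩ := hasSum_norlundCoeff_div_of_re_pos hγ hs h1 h2 h
  have hxc : (x : ℂ) ≠ 0 := by exact_mod_cast hx.ne'
  have hγN : ∀ N : ℕ, 0 < (γ + N).re := fun N ↦ by simp; positivity
  let F : ℕ → ℝ → ℂ := fun N t ↦ (x : ℂ) ^ (-α') * (norlundCoeff α α' β β' γ N / poch γ N) *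
    ((x : ℂ) ^ N)⁻¹ * ((t : ℂ) ^ (s - 1) * ((x - t : ℝ) : ℂ) ^ (γ + N - 1))
  have hF : ∀ N, IntegrableOn (F N) (Set.Ioo 0 x) := fun N ↦
    (integrableOn_beta hs (hγN N) hx).const_mul _
  have hpt : ∀ t ∈ Set.Ioo 0 x, HasSum (fun N ↦ F N t)
      (msmKernel α α' β β' γ x t * (t : ℂ) ^ (s - 1)) := by
    intro t ht
    have hk := (hasSum_kernel hγ α α' β β' ht).mul_left
      (((x - t : ℝ) : ℂ) ^ (γ - 1) * (t : ℂ) ^ (s - 1))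
    have e : msmKernel α α' β β' γ x t * (t : ℂ) ^ (s - 1) =
        ((x - t : ℝ) : ℂ) ^ (γ - 1) * (t : ℂ) ^ (s - 1) * ((t : ℂ) ^ (-α') *
          appellF3 α α' β β' γ (1 - (t : ℂ) / x) (1 - (x : ℂ) / t)) := by
      rw [msmKernel]
      ring
    rw [e]
    refine hk.congr_fun fun N ↦ ?_
    have hxt : ((x - t : ℝ) : ℂ) ≠ 0 := by exact_mod_cast (sub_pos.2 ht.2).ne'
    have e1 : ((x - t : ℝ) : ℂ) ^ (γ + N - 1) =
        ((x - t : ℝ) : ℂ) ^ (γ - 1) * ((x - t : ℝ) : ℂ) ^ N := by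
      rw [← Complex.cpow_natCast, ← Complex.cpow_add _ _ hxt]
      congr 1
      ring
    have e2 : 1 - (t : ℂ) / x = ((x - t : ℝ) : ℂ) * (x : ℂ)⁻¹ := by
      push_cast
      field_simp
    simp only [F]
    rw [e1, e2, mul_pow, inv_pow]
    ring
  have hint : ∀ N, ∫ t in Set.Ioo 0 x, F N t = (x : ℂ) ^ (s + γ - α' - 1) *
      (Complex.Gamma γ * (Complex.Gamma s *
        (norlundCoeff α α' β β' γ N / Complex.Gamma (γ + s + N)))) := by
    intro N
    simp only [F]
    rw [integral_const_mul, setIntegral_beta hs (hγN N) hx,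
      Gamma_add_nat (Complex.Gamma_ne_zero_of_re_pos hγ)]
    have hp := poch_ne_zero hγ N
    have e : (x : ℂ) ^ (s + (γ + N) - 1) = (x : ℂ) ^ (s + γ - 1) * (x : ℂ) ^ N := by
      rw [← Complex.cpow_natCast, ← Complex.cpow_add _ _ hxc]
      congr 1
      ring
    have e' : (x : ℂ) ^ (s + γ - α' - 1) = (x : ℂ) ^ (-α') * (x : ℂ) ^ (s + γ - 1) := by
      rw [← Complex.cpow_add _ _ hxc]
      congr 1
      ring
    have hxN : (x : ℂ) ^ N ≠ 0 := pow_ne_zero _ hxc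
    have hΓ : Complex.Gamma (γ + s + N) ≠ 0 := Complex.Gamma_ne_zero_of_re_pos (by simp; positivity)
    rw [e, e', show s + (γ + N) = γ + s + N by ring]
    field_simp
  have hnorm : Summable fun N ↦ ∫ t in Set.Ioo 0 x, ‖F N t‖ := by
    refine (hsumm.mul_left (‖(x : ℂ) ^ (-α')‖ * x ^ (s.re + γ.re - 1) * Real.Gamma s.re *
      Real.Gamma γ.re)).of_nonneg_of_le (fun N ↦ integral_nonneg fun _ ↦ norm_nonneg _) fun N ↦ ?_
    have hΓs := Real.Gamma_pos_of_pos hs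
    have hΓγ := Real.Gamma_pos_of_pos hγ
    have hΓN : 0 < Real.Gamma ((γ + s).re + N) :=
      Real.Gamma_pos_of_pos (by rw [Complex.add_re]; positivity)
    have hp : 0 < ‖poch γ N‖ := norm_pos_iff.2 (poch_ne_zero hγ N)
    have hle := norm_poch_ofReal_re_le hγ N
    have e1 : (γ + N).re = γ.re + N := by simp
    have e2 : s.re + (γ.re + N) = (γ + s).re + N := by simp; ring
    have e3 : x ^ (s.re + (γ.re + N) - 1) = x ^ (s.re + γ.re - 1) * x ^ N := by
      rw [← Real.rpow_natCast, ← Real.rpow_add hx]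
      congr 1
      ring
    have e4 : ∫ t in Set.Ioo 0 x, ‖F N t‖ = ‖(x : ℂ) ^ (-α')‖ *
        (‖norlundCoeff α α' β β' γ N‖ / ‖poch γ N‖) * (x ^ N)⁻¹ * (x ^ (s.re + (γ.re + N) - 1) *
        (Real.Gamma s.re * Real.Gamma (γ.re + N) / Real.Gamma (s.re + (γ.re + N)))) := by
      rw [← e1, ← setIntegral_norm_beta hs (hγN N) hx, ← integral_const_mul]
      simp only [F, norm_mul, norm_div, norm_inv, norm_pow, Complex.norm_real,
        Real.norm_of_nonneg hx.le]
    rw [e4, e3, e2, realGamma_add_nat hγ]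
    calc _ = ‖(x : ℂ) ^ (-α')‖ * x ^ (s.re + γ.re - 1) * Real.Gamma s.re * Real.Gamma γ.re *
          (‖norlundCoeff α α' β β' γ N‖ / Real.Gamma ((γ + s).re + N)) *
          (‖poch (γ.re : ℂ) N‖ / ‖poch γ N‖) := by field_simp
      _ ≤ ‖(x : ℂ) ^ (-α')‖ * x ^ (s.re + γ.re - 1) * Real.Gamma s.re * Real.Gamma γ.re *
          (‖norlundCoeff α α' β β' γ N‖ / Real.Gamma ((γ + s).re + N)) * 1 := by
        gcongr
        exact (div_le_one hp).2 hle
      _ = _ := mul_one _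
  have hae : ∀ᵐ t ∂(volume.restrict (Set.Ioo 0 x)), HasSum (fun N ↦ F N t)
      (msmKernel α α' β β' γ x t * (t : ℂ) ^ (s - 1)) :=
    (ae_restrict_iff' measurableSet_Ioo).2 (Eventually.of_forall hpt)
  refine ⟨integrable_of_hasSum hF hnorm hae, ?_⟩
  have h3 := hasSum_integral_of_summable_integral_norm hF hnorm
  rw [integral_congr_ae (hae.mono fun t ht ↦ ht.tsum_eq)] at h3
  simp only [hint] at h3
  exact h3.unique (((hsum.mul_left _).mul_left _).mul_left _)

/-- The Mellin transform of the kernel on `(0, x)`. When neither `Re α'` nor `Re β` is positive,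
`Re (γ - α' - β)` is, and `α'` and `β'` are interchanged. -/
theorem msmKernel_mellin {α α' β β' γ s : ℂ} (hγ : 0 < γ.re) (hs : 0 < s.re)
    (h1 : 0 < (s + β' - α').re) (h2 : 0 < (s + γ - α - α' - β).re) {x : ℝ} (hx : 0 < x) :
    IntegrableOn (fun t ↦ msmKernel α α' β β' γ x t * (t : ℂ) ^ (s - 1)) (Set.Ioo 0 x) ∧
    ∫ t in Set.Ioo 0 x, msmKernel α α' β β' γ x t * (t : ℂ) ^ (s - 1) =
      (x : ℂ) ^ (s + γ - α' - 1) *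
        (Complex.Gamma γ * (Complex.Gamma s * norlundProd α α' β β' γ s)) := by
  by_cases h : 0 < α'.re ∨ 0 < β.re
  · exact msmKernel_mellin_of_re_pos hγ hs h1 h2 (h.imp_right Or.inl) hx
  · have h3 : 0 < (γ - β - α').re := by
      push Not at h
      simp
      linarith
    have key := msmKernel_mellin_of_re_pos (α := α) (α' := β') (β := β) (β' := α') (γ := γ)
      (s := s + β' - α') hγ h1 (by convert hs using 2; ring) (by convert h2 using 2; ring)
      (Or.inr (Or.inr h3)) hx
    have e : ∀ t ∈ Set.Ioo 0 x, msmKernel α β' β α' γ x t * (t : ℂ) ^ (s + β' - α' - 1) =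
        msmKernel α α' β β' γ x t * (t : ℂ) ^ (s - 1) := by
      intro t ht
      have htc : (t : ℂ) ≠ 0 := by exact_mod_cast ht.1.ne'
      have e1 : (t : ℂ) ^ (-β') * (t : ℂ) ^ (s + β' - α' - 1) =
          (t : ℂ) ^ (-α') * (t : ℂ) ^ (s - 1) := by
        rw [← Complex.cpow_add _ _ htc, ← Complex.cpow_add _ _ htc]
        congr 1
        ring
      rw [msmKernel, msmKernel, appellF3_swap]
      linear_combination (((x - t : ℝ) : ℂ) ^ (γ - 1) *
        appellF3 α α' β β' γ (1 - (t : ℂ) / (x : ℂ)) (1 - (x : ℂ) / (t : ℂ))) * e1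
    refine ⟨key.1.congr_fun e measurableSet_Ioo, ?_⟩
    rw [← setIntegral_congr_fun measurableSet_Ioo e, key.2, norlundProd, norlundProd]
    ring_nf

/-! ### The generalized Bessel function and the image formula -/

/-- A lower bound for `|Γ(κ + k)|` as `k → ∞` rests on this. -/
theorem one_le_norm_poch {c : ℂ} (hc : 1 ≤ c.re) (n : ℕ) : 1 ≤ ‖poch c n‖ := by
  induction n with
  | zero => simp [poch_zero]
  | succ n ih =>
    rw [poch_succ, norm_mul]
    refine one_le_mul_of_one_le_of_one_le ih (le_trans ?_ (Complex.re_le_norm _))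
    rw [Complex.add_re, Complex.natCast_re]
    linarith [(n.cast_nonneg : (0 : ℝ) ≤ n)]

/-- The power series of `(z / 2)^(-p) W_{p,b,c}(z)` in powers of `(z / 2)^2` converges absolutely
everywhere; `κ` may be a pole of `Γ` here. -/
theorem summable_genBessel_coeff (c κ : ℂ) {r : ℝ} (hr : 0 ≤ r) :
    Summable fun k : ℕ ↦ ‖(-1) ^ k * c ^ k / (Complex.Gamma (κ + k) * (k ! : ℂ))‖ * r ^ k := by
  obtain ⟨M, hM⟩ := exists_nat_gt (1 - κ.re)
  have hre : 1 ≤ (κ + M).re := by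
    rw [Complex.add_re, Complex.natCast_re]
    linarith
  have hΓ := Complex.Gamma_ne_zero_of_re_pos (zero_lt_one.trans_le hre)
  refine Summable.of_norm_bounded_eventually_nat
    ((Real.summable_pow_div_factorial (‖c‖ * r)).mul_left ‖Complex.Gamma (κ + M)‖⁻¹) ?_
  filter_upwards [eventually_ge_atTop M] with k hk
  obtain ⟨j, rfl⟩ := Nat.exists_eq_add_of_le hk
  have h1 := one_le_norm_poch hre j
  have h2 : 0 < ‖Complex.Gamma (κ + M)‖ := norm_pos_iff.2 hΓ
  have h3 : ‖Complex.Gamma (κ + (M + j : ℕ))‖⁻¹ ≤ ‖Complex.Gamma (κ + M)‖⁻¹ := by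
    rw [Nat.cast_add, ← add_assoc, Gamma_add_nat hΓ, norm_mul]
    exact inv_anti₀ h2 (le_mul_of_one_le_right h2.le h1)
  rw [Real.norm_of_nonneg (by positivity)]
  calc _ = ‖Complex.Gamma (κ + (M + j : ℕ))‖⁻¹ * ((‖c‖ * r) ^ (M + j) / (M + j) !) := by
        rw [norm_div, norm_mul, norm_mul, norm_pow, norm_pow, norm_neg, norm_one, one_pow,
          Complex.norm_natCast, mul_pow, one_mul, div_eq_mul_inv, mul_inv]
        ring
    _ ≤ _ := by gcongr

/-- The integral and the Wright series converge, and the image formula holds. -/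
theorem theorem1 (α α' β β' γ ρ p b c κ : ℂ) (hκ : κ = p + (b + 1) / 2)
    (hκ_ne : ∀ n : ℕ, κ ≠ -(n : ℂ)) (hγ : 0 < γ.re)
    (hρ : max 0 (max (α + α' + β - γ).re (α' - β').re) < (ρ + p).re)
    (x : ℝ) (hx : 0 < x) :
    IntervalIntegrable
      (msmLeftIntegrand α α' β β' γ (fun t => (t : ℂ) ^ (ρ - 1) * genBessel p b c (t : ℂ)) x)
      MeasureTheory.volume 0 x ∧
    Summable (wrightTerm
      ![(ρ + p, 2), (ρ + p + γ - α - α' - β, 2), (ρ + p + β' - α', 2)]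
      ![(ρ + p + β', 2), (ρ + p + γ - α - α', 2), (ρ + p + γ - α' - β, 2), (κ, 1)]
      (-(c * (x : ℂ) ^ 2) / 4)) ∧
    msmLeft α α' β β' γ (fun t => (t : ℂ) ^ (ρ - 1) * genBessel p b c (t : ℂ)) x =
      (x : ℂ) ^ (ρ + p - α - α' + γ - 1) / 2 ^ p *
        wrightPsi
          ![(ρ + p, 2), (ρ + p + γ - α - α' - β, 2), (ρ + p + β' - α', 2)]
          ![(ρ + p + β', 2), (ρ + p + γ - α - α', 2), (ρ + p + γ - α' - β, 2), (κ, 1)]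
          (-(c * (x : ℂ) ^ 2) / 4) := by
  obtain ⟨hσ0, hσ12⟩ := max_lt_iff.1 hρ
  obtain ⟨hσ1, hσ2⟩ := max_lt_iff.1 hσ12
  set σ := ρ + p with hσ
  have hxc : (x : ℂ) ≠ 0 := by exact_mod_cast hx.ne'
  have h2p : (2 : ℂ) ^ p ≠ 0 := by simp [Complex.cpow_eq_zero_iff]
  -- `t^(ρ-1) W(t) = ∑ A k * t^(σ + 2k - 1)`, and `H` is the kernel times `t^(σ-1)`.
  let A : ℕ → ℂ := fun k ↦ ((2 : ℂ) ^ p)⁻¹ *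
    ((-1) ^ k * c ^ k / (Complex.Gamma (κ + k) * (k ! : ℂ))) * ((4 : ℂ) ^ k)⁻¹
  let H : ℝ → ℂ := fun t ↦ msmKernel α α' β β' γ x t * (t : ℂ) ^ (σ - 1)
  have hmel : ∀ k : ℕ, IntegrableOn (fun t ↦ msmKernel α α' β β' γ x t *
        (t : ℂ) ^ (σ + 2 * k - 1)) (Set.Ioo 0 x) ∧
      ∫ t in Set.Ioo 0 x, msmKernel α α' β β' γ x t * (t : ℂ) ^ (σ + 2 * k - 1) =
        (x : ℂ) ^ (σ + 2 * k + γ - α' - 1) * (Complex.Gamma γ * (Complex.Gamma (σ + 2 * k) *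
          norlundProd α α' β β' γ (σ + 2 * k))) := by
    intro k
    have hk : (0 : ℝ) ≤ k := k.cast_nonneg
    refine msmKernel_mellin hγ ?_ ?_ ?_ hx
    · simp at hσ0 ⊢
      linarith
    · simp at hσ2 ⊢
      linarith
    · simp at hσ1 ⊢
      linarith
  have hH : IntegrableOn H (Set.Ioo 0 x) := by simpa using (hmel 0).1
  let F : ℕ → ℝ → ℂ := fun k t ↦ A k * (msmKernel α α' β β' γ x t * (t : ℂ) ^ (σ + 2 * k - 1))
  have hFH : ∀ k, ∀ t ∈ Set.Ioo 0 x, F k t = A k * (t : ℂ) ^ (2 * k) * H t := by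
    intro k t ht
    have htc : (t : ℂ) ≠ 0 := by exact_mod_cast ht.1.ne'
    have e : (t : ℂ) ^ (σ + 2 * k - 1) = (t : ℂ) ^ (2 * k) * (t : ℂ) ^ (σ - 1) := by
      rw [← Complex.cpow_natCast, ← Complex.cpow_add _ _ htc]
      congr 1
      push_cast
      ring
    simp only [F, H, e]
    ring
  have hAsum : Summable fun k ↦ ‖A k‖ * x ^ (2 * k) := by
    refine ((summable_genBessel_coeff c κ (r := x ^ 2 / 4) (by positivity)).mul_left
      ‖((2 : ℂ) ^ p)⁻¹‖).congr fun k ↦ ?_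
    simp only [A, norm_mul _ ((4 : ℂ) ^ k)⁻¹, norm_mul ((2 : ℂ) ^ p)⁻¹, norm_inv ((4 : ℂ) ^ k),
      norm_pow (4 : ℂ), div_pow, pow_mul]
    simp only [Complex.norm_ofNat]
    ring
  have hFint : ∀ k, IntegrableOn (F k) (Set.Ioo 0 x) := fun k ↦ (hmel k).1.const_mul _
  have hFle : ∀ k, ∀ t ∈ Set.Ioo 0 x, ‖F k t‖ ≤ ‖A k‖ * x ^ (2 * k) * ‖H t‖ := by
    intro k t ht
    rw [hFH k t ht, norm_mul, norm_mul, norm_pow, Complex.norm_real, Real.norm_of_nonneg ht.1.le]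
    have := ht.1.le
    have := ht.2.le
    gcongr
  have hFnorm : Summable fun k ↦ ∫ t in Set.Ioo 0 x, ‖F k t‖ := by
    refine (hAsum.mul_right (∫ t in Set.Ioo 0 x, ‖H t‖)).of_nonneg_of_le
      (fun k ↦ integral_nonneg fun _ ↦ norm_nonneg _) fun k ↦ ?_
    rw [← integral_const_mul]
    exact setIntegral_mono_on (hFint k).norm (hH.norm.const_mul _) measurableSet_Ioo (hFle k)
  have hpt : ∀ t ∈ Set.Ioo 0 x, HasSum (fun k ↦ F k t)
      (msmLeftIntegrand α α' β β' γ
        (fun t => (t : ℂ) ^ (ρ - 1) * genBessel p b c (t : ℂ)) x t) := by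
    intro t ht
    have htc : (t : ℂ) ≠ 0 := by exact_mod_cast ht.1.ne'
    have hs : Summable fun k ↦ F k t :=
      Summable.of_norm_bounded (hAsum.mul_right ‖H t‖) fun k ↦ hFle k t ht
    convert hs.hasSum using 1
    rw [msmLeftIntegrand, genBessel, ← tsum_mul_left, ← tsum_mul_left]
    refine tsum_congr fun k ↦ ?_
    have e1 : ((t : ℂ) / 2) ^ (2 * (k : ℂ) + p) =
        (t : ℂ) ^ (2 * k) * (t : ℂ) ^ p * ((2 : ℂ) ^ p)⁻¹ * ((4 : ℂ) ^ k)⁻¹ := by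
      have h2 : (t : ℂ) / 2 = ((t / 2 : ℝ) : ℂ) := by push_cast; rfl
      have h3 : ((t / 2 : ℝ) : ℂ) ^ p = (t : ℂ) ^ p * ((2 : ℂ) ^ p)⁻¹ := by
        rw [eq_mul_inv_iff_mul_eq₀ h2p]
        have := Complex.mul_cpow_ofReal_nonneg (a := t / 2) (b := 2) (by linarith [ht.1])
          (by norm_num) p
        push_cast at this ⊢
        rw [← this, div_mul_cancel₀ _ (by norm_num)]
      have h4 : (t : ℂ) / 2 ≠ 0 := div_ne_zero htc (by norm_num)
      rw [Complex.cpow_add _ _ h4, show 2 * (k : ℂ) = ((2 * k : ℕ) : ℂ) by push_cast; rfl,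
        Complex.cpow_natCast, h2, h3, ← h2, div_pow, pow_mul (2 : ℂ)]
      norm_num
      ring
    have e2 : (t : ℂ) ^ (σ - 1) = (t : ℂ) ^ (ρ - 1) * (t : ℂ) ^ p := by
      rw [← Complex.cpow_add _ _ htc, hσ]
      congr 1
      ring
    rw [hFH k t ht, e1, ← hκ]
    simp only [A, H, msmKernel]
    rw [e2]
    ring
  have hae : ∀ᵐ t ∂(volume.restrict (Set.Ioo 0 x)), HasSum (fun k ↦ F k t)
      (msmLeftIntegrand α α' β β' γ
        (fun t => (t : ℂ) ^ (ρ - 1) * genBessel p b c (t : ℂ)) x t) :=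
    (ae_restrict_iff' measurableSet_Ioo).2 (Eventually.of_forall hpt)
  set P : ℂ := (x : ℂ) ^ (σ - α - α' + γ - 1) / 2 ^ p with hP
  have hP0 : P ≠ 0 := div_ne_zero (by simp [Complex.cpow_eq_zero_iff, hxc]) h2p
  have hsum : HasSum (fun k ↦ P * wrightTerm
      ![(σ, 2), (σ + γ - α - α' - β, 2), (σ + β' - α', 2)]
      ![(σ + β', 2), (σ + γ - α - α', 2), (σ + γ - α' - β, 2), (κ, 1)]
      (-(c * (x : ℂ) ^ 2) / 4) k)
      (msmLeft α α' β β' γ (fun t => (t : ℂ) ^ (ρ - 1) * genBessel p b c (t : ℂ)) x) := by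
    have h3 := hasSum_integral_of_summable_integral_norm hFint hFnorm
    rw [integral_congr_ae (hae.mono fun t ht ↦ ht.tsum_eq)] at h3
    rw [msmLeft, intervalIntegral.integral_of_le hx.le, integral_Ioc_eq_integral_Ioo]
    refine (h3.mul_left ((x : ℂ) ^ (-α) / Complex.Gamma γ)).congr_fun fun k ↦ ?_
    have hΓ := Complex.Gamma_ne_zero_of_re_pos hγ
    have e1 : (x : ℂ) ^ (-α) * (x : ℂ) ^ (σ + 2 * k + γ - α' - 1) =
        (x : ℂ) ^ (σ - α - α' + γ - 1) * (x : ℂ) ^ (2 * k) := by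
      rw [← Complex.cpow_natCast, ← Complex.cpow_add _ _ hxc, ← Complex.cpow_add _ _ hxc]
      congr 1
      push_cast
      ring
    simp only [F]
    rw [integral_const_mul, (hmel k).2]
    have e2 : (x : ℂ) ^ (-α) / Complex.Gamma γ * (A k * ((x : ℂ) ^ (σ + 2 * k + γ - α' - 1) *
        (Complex.Gamma γ * (Complex.Gamma (σ + 2 * k) * norlundProd α α' β β' γ (σ + 2 * k))))) =
        ((x : ℂ) ^ (-α) * (x : ℂ) ^ (σ + 2 * k + γ - α' - 1)) * A k *
          (Complex.Gamma (σ + 2 * k) * norlundProd α α' β β' γ (σ + 2 * k)) := by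
      field_simp
    rw [e2, e1, wrightTerm, norlundProd, hP]
    simp only [Fin.prod_univ_succ, A]
    simp
    rw [show σ + 2 * (k : ℂ) + β' - α' = σ + β' - α' + 2 * k by ring,
      show σ + 2 * (k : ℂ) + γ - α - α' - β = σ + γ - α - α' - β + 2 * k by ring,
      show σ + 2 * (k : ℂ) + β' = σ + β' + 2 * k by ring,
      show σ + 2 * (k : ℂ) + γ - α - α' = σ + γ - α - α' + 2 * k by ring,
      show σ + 2 * (k : ℂ) + γ - α' - β = σ + γ - α' - β + 2 * k by ring,
      div_pow, neg_pow, mul_pow, ← pow_mul]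
    simp only [div_eq_mul_inv, mul_inv]
    ring
  refine ⟨?_, (summable_mul_left_iff hP0).1 hsum.summable, ?_⟩
  · rw [intervalIntegrable_iff_integrableOn_Ioo_of_le hx.le]
    exact integrable_of_hasSum hFint hFnorm hae
  · rw [wrightPsi, ← tsum_mul_left]
    exact hsum.tsum_eq.symm
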